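/- For a real number $\lambda>0$ let $\mathcal F_\lambda$ be the holomorphic foliation germ at $0\in\mathbb C^2$ represented by the vector field $\lambda x\frac{\partial}{\partial x}+y\frac{\partial}{\partial y}$ on $\mathbb{C}^2$. Two such germs $\mathcal F,\mathcal G$ are \emph{topologically equivalent} if there is a homeomorphism $\phi:V\to V'$ of open neighborhoods of $0$ with $\phi(0)=0$ that maps the leaves of $\mathcal F$ in $V\setminus\{0\}$ onto the leaves of $\mathcal G$ in $V'\setminus\{0\}$. The \emph{trace foliation} $\mathcal F_\lambda\cap S^3$ is the real one-dimensional foliation of the unit sphere $S^3\subset\mathbb C^2$ whose tangent line at each point is the intersection of the tangent spaces of $S^3$ and of the leaf of $\mathcal F_\lambda$. Let $\lambda,\mu$ be positive rational numbers. Then: (1) $\mathcal F_\lambda$ and $\mathcal F_\mu$ are topologically equivalent if and only if $\lambda=\mu$ or $\lambda=1/\mu$. (2) Write $\lambda=p/q$ with coprime positive integers $p,q$. Every leaf of $\mathcal F_\lambda\cap S^3$ is closed. The circles $\{x=0\}\cap S^3$ and $\{y=0\}\cap S^3$ are leaves (the exceptional leaves). Every other leaf lies on a torus $\{|x|=r\}\cap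 S^3$ with $0<r<1$ and is a torus knot of type $(p,q)$ on it: a simple closed curve which, suitably oriented, winds $p$ times around $\{x=0\}\cap S^3$ and $q$ times around $\{y=0\}\cap S^3$. (3) The holonomy germ of $\mathcal F_\lambda\cap S^3$ obtained by following the exceptional leaf $\{x=0\}\cap S^3$ once around has order $q$, and that of $\{y=0\}\cap S^3$ has order $p$ (independently of the chosen transversal and parametrization). These orders are topological invariants: every homeomorphism of $S^3$ mapping the leaves of $\mathcal F_\lambda\cap S^3$ onto the leaves of $\mathcal F_\mu\cap S^3$ maps each leaf to a leaf with the same order of holonomy; and if the germs $\mathcal F_\lambda$ and $\mathcal F_\mu$ are topologically equivalent, then the unordered pairs of orders of the holonomies along the two exceptional leaves of $\mathcal F_\lambda\cap S^3$ and of $\mathcal F_\mu\cap S^3$ coincide. -/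

import Mathlib

open Set Filter Topology

namespace HolFoliation

noncomputable section

/-- Complex `n`-space with its Hermitian norm. -/
abbrev Cn (n : ℕ) : Type := EuclideanSpace ℂ (Fin n)

/-! ### Foliation germs of rank one with an isolated singularity -/

/-- A pair `[U, θ]`: an open neighbourhood `U` of `0` in `ℂⁿ` and a holomorphic vector field `θ` on
`U` that vanishes only in `0`. It represents a germ of a holomorphic foliation of rank `1` with an
isolated singularity in `0`. -/
structure Foliation (n : ℕ) where
  U : Set (Cn n)
  isOpen_U : IsOpen U
  zero_mem : (0 : Cn n) ∈ U
  θ : Cn n → Cn n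
  holomorphic : DifferentiableOn ℂ θ U
  eq_zero_iff : ∀ z ∈ U, θ z = 0 ↔ z = 0

/-- The leaf through `p`, inside `A`, of a distribution `Δ` of real tangent vectors: the points that
can be reached from `p` by a `C¹` path in `A` which is everywhere tangent to `Δ`. -/
def leafOf {n : ℕ} (Δ : Cn n → Set (Cn n)) (A : Set (Cn n)) (p : Cn n) : Set (Cn n) :=
  {q | ∃ γ : ℝ → Cn n, ContDiff ℝ 1 γ ∧ γ 0 = p ∧ γ 1 = q ∧
    ∀ t ∈ Icc (0 : ℝ) 1, γ t ∈ A ∧ deriv γ t ∈ Δ (γ t)}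

/-- The complex line field spanned by the vector field: the tangent spaces of the leaves. -/
def tangentLine {n : ℕ} (F : Foliation n) (z : Cn n) : Set (Cn n) :=
  {v | ∃ c : ℂ, v = c • F.θ z}

/-- The leaf through `p ≠ 0` of the foliation restricted to `V ⊆ U`, i.e. the maximal (immersed)
integral curve of `θ` through `p` in `V`; leaves do not contain the singular point. -/
def Foliation.leaf {n : ℕ} (F : Foliation n) (V : Set (Cn n)) (p : Cn n) : Set (Cn n) :=
  leafOf (tangentLine F) (V \ {0}) p

/-- Topological equivalence of foliation germs: a homeomorphism `φ : V → V'` of open neighbourhoods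
`V ⊆ U`, `V' ⊆ U'` of `0` that fixes `0` and maps the leaves of `F` in `V` onto the leaves of `G` in
`V'`. -/
def Foliation.TopEquiv {n : ℕ} (F G : Foliation n) : Prop :=
  ∃ φ : OpenPartialHomeomorph (Cn n) (Cn n),
    φ.source ⊆ F.U ∧ φ.target ⊆ G.U ∧ (0 : Cn n) ∈ φ.source ∧ φ 0 = 0 ∧
    ∀ p ∈ φ.source, p ≠ 0 → φ '' F.leaf φ.source p = G.leaf φ.target (φ p)

/-- The foliation germ `F_l` in `ℂ²` represented by the vector field `l x ∂/∂x + y ∂/∂y`, for a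
positive real number `l`. -/
def linFoliation (l : ℝ) (hl : 0 < l) : Foliation 2 where
  U := univ
  isOpen_U := isOpen_univ
  zero_mem := mem_univ _
  θ := fun z => !₂[(l : ℂ) * z 0, z 1]
  holomorphic := by
    refine Differentiable.differentiableOn ?_
    rw [differentiable_piLp]
    intro i
    fin_cases i <;> simp <;> fun_prop
  eq_zero_iff := by
    intro z _
    have hl' : (l : ℂ) ≠ 0 := by exact_mod_cast hl.ne'
    constructor
    · intro h
      have h0 := congrArg (fun w : Cn 2 => w 0) h
      have h1 := congrArg (fun w : Cn 2 => w 1) h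
      simp [hl'] at h0 h1
      ext i
      fin_cases i <;> simp [h0, h1]
    · rintro rfl
      ext i
      fin_cases i <;> simp

/-! ### The trace foliation on the unit sphere -/

/-- The unit sphere in `ℂⁿ`. -/
abbrev Sph (n : ℕ) : Type := Metric.sphere (0 : Cn n) 1

/-- The trace distribution: the vectors tangent both to the leaf of `F` through `z` and to the
sphere centred in `0` through `z`. -/
def traceDistribution {n : ℕ} (F : Foliation n) (z : Cn n) : Set (Cn n) :=
  {v | v ∈ tangentLine F z ∧ (inner ℂ z v).re = 0}

/-- The leaf through `p` of the trace foliation of `F` on the unit sphere. -/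
def Foliation.traceLeaf {n : ℕ} (F : Foliation n) (p : Sph n) : Set (Sph n) :=
  {q | (q : Cn n) ∈ leafOf (traceDistribution F) (Metric.sphere 0 1) p}

/-- `γ` restricted to `[0, 1]` is a simple closed curve with image `L`. -/
structure IsSimpleLoop {X : Type*} [TopologicalSpace X] (γ : ℝ → X) (L : Set X) : Prop where
  continuousOn : ContinuousOn γ (Icc 0 1)
  closed : γ 1 = γ 0
  injOn : InjOn γ (Ico 0 1)
  image_eq : γ '' Icc 0 1 = L

/-- The closed curve `c` on `[0, 1]` avoids `0` and has winding number `k` around `0`: a continuous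
choice of its argument increases by `2πk`. -/
def HasWindingNumber (c : ℝ → ℂ) (k : ℤ) : Prop :=
  ∃ α : ℝ → ℝ, ContinuousOn α (Icc 0 1) ∧
    (∀ t ∈ Icc (0 : ℝ) 1, c t ≠ 0 ∧ c t = (‖c t‖ : ℂ) * Complex.exp (α t * Complex.I)) ∧
    α 1 - α 0 = 2 * Real.pi * k

/-- `K` is a torus knot of type `(p, q)` on the torus `{|x| = r}` of the unit sphere in `ℂ²`
(`0 < r < 1`): a simple closed curve on that torus which winds `p` times around `{x = 0}` and `q`
times around `{y = 0}`. -/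
def IsTorusKnot (r : ℝ) (p q : ℤ) (K : Set (Sph 2)) : Prop :=
  0 < r ∧ r < 1 ∧ (∀ z ∈ K, ‖(z : Cn 2) 0‖ = r) ∧
    ∃ γ : ℝ → Sph 2, IsSimpleLoop γ K ∧
      HasWindingNumber (fun t => (γ t : Cn 2) 0) p ∧ HasWindingNumber (fun t => (γ t : Cn 2) 1) q

/-! ### Holonomy of one-dimensional foliations

A foliation of a space `X` is given here by the map `leaf` that sends a point to its leaf. A
continuous path that stays in one leaf is automatically continuous for the leaf topology. -/

section Holonomy

variable {X : Type*} [TopologicalSpace X]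

/-- `D` is a transversal through `x` of a one-dimensional foliation: `x ∈ D`, and a neighbourhood of
`D` is a product `D × ℝ` in which `D` is `D × {0}` and the lines `{z} × ℝ` lie in leaves. -/
def IsTransversal (leaf : X → Set X) (D : Set X) (x : X) : Prop :=
  x ∈ D ∧ ∃ e : D × ℝ → X, IsOpenEmbedding e ∧
    ∀ z : D, e (z, 0) = z ∧ ∀ s : ℝ, e (z, s) ∈ leaf z

/-- `h` represents the holonomy germ `(D, γ 0) → (D, γ 0)` along the loop `γ` in a leaf: for the
points `z` of a neighbourhood `N` of `γ 0` in `D` there are paths `H (z, ·)` from `z` to `h z ∈ D`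
in the leaf of `z`, depending continuously on `z`, such that `H (γ 0, ·)` is `γ`. -/
def IsHolonomy (leaf : X → Set X) (D : Set X) (γ : ℝ → X) (h : X → X) : Prop :=
  ∃ N ⊆ D, N ∈ 𝓝[D] (γ 0) ∧ ∃ H : X × ℝ → X,
    ContinuousOn H (N ×ˢ Icc 0 1) ∧
    (∀ s ∈ Icc (0 : ℝ) 1, H (γ 0, s) = γ s) ∧
    ∀ z ∈ N, H (z, 0) = z ∧ H (z, 1) = h z ∧ h z ∈ D ∧ ∀ s ∈ Icc (0 : ℝ) 1, H (z, s) ∈ leaf z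

/-- The germ at `x` of the self-map `h` of `D` has the finite order `k`. -/
def HasGermOrder (D : Set X) (x : X) (h : X → X) (k : ℕ) : Prop :=
  IsLeast {j : ℕ | 0 < j ∧ h^[j] =ᶠ[𝓝[D] x] id} k

/-- The leaf `L` is a simple closed curve, and the holonomy germ obtained by following it once
around has the finite order `k`. -/
def HasHolonomyOrder (leaf : X → Set X) (L : Set X) (k : ℕ) : Prop :=
  ∃ (γ : ℝ → X) (D : Set X) (h : X → X),
    IsSimpleLoop γ L ∧ (∀ z ∈ L, leaf z = L) ∧ IsTransversal leaf D (γ 0) ∧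
    IsHolonomy leaf D γ h ∧ HasGermOrder D (γ 0) h k

end Holonomy

/-- The circle `{x = 0}` in the unit sphere of `ℂ²`. -/
def circleX : Set (Sph 2) := {z | (z : Cn 2) 0 = 0}

/-- The circle `{y = 0}` in the unit sphere of `ℂ²`. -/
def circleY : Set (Sph 2) := {z | (z : Cn 2) 1 = 0}

end

end HolFoliation

open HolFoliation

/-! ### Continuous logarithms -/

/-! For `l = n 0 / n 1` in lowest terms the leaves are the orbits of the complex flow `wflow n`,
which multiplies the `i`-th coordinate by `exp (n i * s)`. The norm grows strictly with the real
part of the time, so the trace leaves are the orbits under imaginary time (`traceLeaf_eq`). By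
coprimality a point off the axes has period group `2πiℤ`, while on the `i`-th axis the period is
`2πi / n i`. This gives the closed leaves and the torus knots. The first return along the `i`-th
axis is the flow for a time near `± 2π / n i`, so its iterates become trivial exactly at multiples
of `n i` (`iterate_holonomy_eventuallyEq_iff`).

A homeomorphism of germs need not preserve the sphere, so the orders have to be recovered from the
complex leaves. There a transversal is avoided by taking the open set `V` itself as `D`: trivial
holonomy along a loop then means that the loop extends to a continuous family of loops in all nearby
leaves. A loop followed `leafOrder` times has this property (`isHolonomy_id_leafOrder`), and a
`k`-fold circle in the `i`-th axis has it only if `n i ∣ k` (`dvd_of_isHolonomy_id`). Since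
leaf-preserving homeomorphisms transport the property, `n i` divides the order of the leaf into
which the `i`-th axis is sent (`leafOrder_map_dvd`). An axis of weight greater than `1` must
therefore go to an axis, and by symmetry the two weights agree. The remaining weights are `1`, so
the unordered pairs of weights coincide (`LeafEquiv.weights_eq`).

The common technical tool is that a continuous path in an orbit has a continuous time, obtained from
the uniqueness and existence of continuous logarithms. -/

theorem exists_continuous_log {g : ℝ → ℂ} (hg : Continuous g) (h0 : ∀ t, g t ≠ 0) {e : ℂ}
    (he : Complex.exp e = g 0) :
    ∃ f : ℝ → ℂ, Continuous f ∧ f 0 = e ∧ ∀ t, Complex.exp (f t) = g t := by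
  obtain ⟨F, ⟨hF0, hF⟩, -⟩ := Complex.isCoveringMapOn_exp.existsUnique_continuousMap_lifts
    ⟨g, hg⟩ (a₀ := (0 : ℝ)) (e₀ := e) he (fun a => h0 a)
  exact ⟨F, F.continuous, hF0, fun t => congrFun hF t⟩

theorem eq_one_of_pow_eq_one {g : ℝ → ℂ} (hg : Continuous g) {n : ℕ} (hn : 0 < n)
    (hpow : ∀ t, g t ^ n = 1) (h0 : g 0 = 1) (t : ℝ) : g t = 1 := by
  have hfin : {z : ℂ | z ^ n = 1}.Finite := by
    refine (Polynomial.nthRootsFinset n (1 : ℂ)).finite_toSet.subset fun z hz => ?_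
    rw [Finset.mem_coe, Polynomial.mem_nthRootsFinset hn]
    exact hz
  rw [← h0]
  exact isPreconnected_univ.constant_of_mapsTo hfin.isDiscrete hg.continuousOn
    (fun t _ => hpow t) (mem_univ _) (mem_univ _)

/-- Two continuous logarithms of the same function that agree at `0` are equal. -/
theorem eq_of_exp_eq {f g : ℝ → ℂ} (hf : Continuous f) (hg : Continuous g)
    (h : ∀ t, Complex.exp (f t) = Complex.exp (g t)) (h0 : f 0 = g 0) (t : ℝ) : f t = g t := by
  obtain ⟨F, -, hF⟩ := Complex.isCoveringMapOn_exp.existsUnique_continuousMap_lifts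
    ⟨fun t => Complex.exp (g t), by fun_prop⟩ (a₀ := (0 : ℝ)) (e₀ := g 0) rfl
    (fun a => Complex.exp_ne_zero _)
  have h1 := hF ⟨f, hf⟩ ⟨h0, funext h⟩
  have h2 := hF ⟨g, hg⟩ ⟨rfl, rfl⟩
  exact congrFun (congrArg DFunLike.coe (h1.trans h2.symm)) t

/-! ### The weighted flow -/

/-- The complex flow of the vector field `∑ nᵢ zᵢ ∂/∂zᵢ`. -/
noncomputable def wflow (n : Fin 2 → ℕ) (s : ℂ) (z : Cn 2) : Cn 2 :=
  WithLp.toLp 2 fun i => Complex.exp (n i * s) * z i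

section Flow

variable {n : Fin 2 → ℕ}

@[simp] theorem wflow_apply (s : ℂ) (z : Cn 2) (i : Fin 2) :
    wflow n s z i = Complex.exp (n i * s) * z i := rfl

@[simp] theorem wflow_zero_time (z : Cn 2) : wflow n 0 z = z := by
  ext i; simp

theorem wflow_add (s t : ℂ) (z : Cn 2) : wflow n (s + t) z = wflow n s (wflow n t z) := by
  ext i; simp [mul_add, Complex.exp_add, mul_assoc]

theorem wflow_neg_wflow (s : ℂ) (z : Cn 2) : wflow n (-s) (wflow n s z) = z := by
  rw [← wflow_add]; simp

@[fun_prop]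
theorem Continuous.wflow {X : Type*} [TopologicalSpace X] {s : X → ℂ} {z : X → Cn 2}
    (hs : Continuous s) (hz : Continuous z) : Continuous fun x => wflow n (s x) (z x) := by
  refine (PiLp.continuous_toLp 2 _).comp (continuous_pi fun i => ?_)
  fun_prop

theorem Cn.ne_zero_iff {z : Cn 2} : z ≠ 0 ↔ ∃ i, z i ≠ 0 := by
  rw [← not_iff_not]
  push Not
  constructor
  · rintro rfl i; rfl
  · intro h; ext i; exact h i

theorem wflow_apply_eq_zero {s : ℂ} {z : Cn 2} {i : Fin 2} : wflow n s z i = 0 ↔ z i = 0 := by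
  simp [Complex.exp_ne_zero]

theorem wflow_ne_zero {s : ℂ} {z : Cn 2} (hz : z ≠ 0) : wflow n s z ≠ 0 := by
  rw [Cn.ne_zero_iff] at hz ⊢
  obtain ⟨i, hi⟩ := hz
  exact ⟨i, fun h => hi (wflow_apply_eq_zero.mp h)⟩

theorem wflow_int_period (k : ℤ) (z : Cn 2) :
    wflow n (k * (2 * Real.pi * Complex.I)) z = z := by
  ext i
  have : Complex.exp (n i * (k * (2 * Real.pi * Complex.I))) = 1 :=
    Complex.exp_eq_one_iff.mpr ⟨n i * k, by push_cast; ring⟩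
  simp [this]

theorem exp_eq_one_of_wflow_eq_self {s : ℂ} {z : Cn 2} (h : wflow n s z = z) {i : Fin 2}
    (hi : z i ≠ 0) : Complex.exp (n i * s) = 1 := by
  have h1 := congrArg (fun w : Cn 2 => w i) h
  simp only [wflow_apply] at h1
  exact mul_right_cancel₀ hi (h1.trans (one_mul _).symm)

/-- Both `n 0 * s` and `n 1 * s` lie in `2πiℤ`; a Bézout relation between the weights puts `s`
itself there. -/
theorem exists_int_of_wflow_eq_self (hc : (n 0).Coprime (n 1)) {s : ℂ} {z : Cn 2}
    (h : wflow n s z = z) (hz : ∀ i, z i ≠ 0) : ∃ k : ℤ, s = k * (2 * Real.pi * Complex.I) := by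
  obtain ⟨a, ha⟩ := Complex.exp_eq_one_iff.mp (exp_eq_one_of_wflow_eq_self h (hz 0))
  obtain ⟨b, hb⟩ := Complex.exp_eq_one_iff.mp (exp_eq_one_of_wflow_eq_self h (hz 1))
  obtain ⟨u, v, huv⟩ : ∃ u v : ℤ, u * n 0 + v * n 1 = 1 :=
    Nat.isCoprime_iff_coprime.mpr hc
  have huv' : (u * n 0 + v * n 1 : ℂ) = 1 := by exact_mod_cast huv
  refine ⟨u * a + v * b, ?_⟩
  push_cast
  linear_combination (-s) * huv' + u * ha + v * hb

/-- A continuous path in a complex orbit is the orbit reparametrized by a continuous time. -/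
theorem exists_continuous_time (hn : ∀ i, 0 < n i) {γ : ℝ → Cn 2} (hγ : Continuous γ) {z : Cn 2}
    (hz : z ≠ 0) (horb : ∀ t, ∃ s, γ t = wflow n s z) {s₀ : ℂ} (h0 : γ 0 = wflow n s₀ z) :
    ∃ S : ℝ → ℂ, Continuous S ∧ S 0 = s₀ ∧ ∀ t, γ t = wflow n (S t) z := by
  obtain ⟨i, hi⟩ := Cn.ne_zero_iff.mp hz
  choose σ hσ using horb
  have hni : ((n i : ℕ) : ℂ) ≠ 0 := by exact_mod_cast (hn i).ne'
  have hcoord : ∀ j, Continuous fun t => γ t j := fun j => by fun_prop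
  obtain ⟨f, hf, hf0, hfe⟩ := exists_continuous_log (g := fun t => γ t i / z i)
    ((hcoord i).div_const _) (fun t => div_ne_zero (by
      rw [hσ t]; exact fun h => hi (wflow_apply_eq_zero.mp h)) hi) (e := n i * s₀)
    (by simp [h0, hi])
  have key : ∀ t, Complex.exp (f t) = Complex.exp (n i * σ t) := by
    intro t; rw [hfe t, hσ t]; simp [hi]
  refine ⟨fun t => f t / n i, by fun_prop, by simp [hf0, hni], fun t => ?_⟩
  ext j
  simp only [wflow_apply]
  by_cases hj : z j = 0
  · simp [hσ t, hj]
  have hne : ∀ t, Complex.exp (n j * (f t / n i)) * z j ≠ 0 := fun t =>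
    mul_ne_zero (Complex.exp_ne_zero _) hj
  -- The time comes from a logarithm of the `i`-th coordinate, which fixes it only up to `2πi / n
  -- i`. In another coordinate the error is thus an `n i`-th root of unity; it is continuous and
  -- starts at `1`.
  have h1 := eq_one_of_pow_eq_one
    (g := fun t => γ t j / (Complex.exp (n j * (f t / n i)) * z j))
    ((hcoord j).div (by fun_prop) hne) (hn i) (fun t => by
      have : γ t j / (Complex.exp (n j * (f t / n i)) * z j)
          = Complex.exp (n j * σ t) / Complex.exp (n j * (f t / n i)) := by
        rw [hσ t]; simp only [wflow_apply]; field_simp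
      rw [this, div_pow, ← Complex.exp_nat_mul, ← Complex.exp_nat_mul]
      have e1 : (n i : ℂ) * (n j * σ t) = n j * (n i * σ t) := by ring
      have e2 : (n i : ℂ) * (n j * (f t / n i)) = n j * f t := by field_simp
      rw [e1, e2, Complex.exp_nat_mul (n i * σ t), Complex.exp_nat_mul (f t), key t, div_self]
      exact pow_ne_zero _ (Complex.exp_ne_zero _)) (by
      have e2 : (n j : ℂ) * (f 0 / n i) = n j * s₀ := by rw [hf0]; field_simp
      simp only [e2, h0, wflow_apply]
      exact div_self (mul_ne_zero (Complex.exp_ne_zero _) hj)) t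
  exact (div_eq_one_iff_eq (hne t)).mp h1

theorem norm_wflow_strictMono (hn : ∀ i, 0 < n i) {s : ℂ} {z : Cn 2} (hz : z ≠ 0)
    (hs : 0 < s.re) : ‖z‖ < ‖wflow n s z‖ := by
  rw [EuclideanSpace.norm_eq, EuclideanSpace.norm_eq]
  refine Real.sqrt_lt_sqrt (by positivity) ?_
  have hexp : ∀ i, 1 < ‖Complex.exp (n i * s)‖ := fun i => by
    rw [Complex.norm_exp]
    have : 0 < (n i : ℝ) := by exact_mod_cast hn i
    simpa using mul_pos this hs
  obtain ⟨i, hi⟩ := Cn.ne_zero_iff.mp hz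
  refine Finset.sum_lt_sum (fun j _ => ?_) ⟨i, Finset.mem_univ i, ?_⟩
  · rw [wflow_apply, norm_mul]
    gcongr
    exact le_mul_of_one_le_left (norm_nonneg _) (hexp j).le
  · rw [wflow_apply, norm_mul]
    gcongr
    exact lt_mul_of_one_lt_left (norm_pos_iff.mpr hi) (hexp i)

theorem re_eq_zero_of_norm_wflow_eq (hn : ∀ i, 0 < n i) {s : ℂ} {z : Cn 2} (hz : z ≠ 0)
    (h : ‖wflow n s z‖ = ‖z‖) : s.re = 0 := by
  rcases lt_trichotomy s.re 0 with hs | hs | hs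
  · have := norm_wflow_strictMono hn (s := -s) (wflow_ne_zero (n := n) (s := s) hz) (by simpa)
    rw [wflow_neg_wflow, h] at this
    exact absurd this (lt_irrefl _)
  · exact hs
  · exact absurd h (norm_wflow_strictMono hn hz hs).ne'

theorem norm_wflow_mul_I (t : ℝ) (z : Cn 2) : ‖wflow n (t * Complex.I) z‖ = ‖z‖ := by
  rw [EuclideanSpace.norm_eq, EuclideanSpace.norm_eq]
  congr 1
  refine Finset.sum_congr rfl fun i _ => ?_
  have : (n i : ℂ) * (t * Complex.I) = ((n i * t : ℝ) : ℂ) * Complex.I := by push_cast; ring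
  rw [wflow_apply, norm_mul, this, Complex.norm_exp_ofReal_mul_I, one_mul]

end Flow

/-! ### Leaves as orbits of the weighted flow -/

/-- A continuous path in an open set of complex numbers can be replaced by a smooth one with the
same end points. -/
theorem exists_contDiff_path {Ω : Set ℂ} (hΩ : IsOpen Ω) {S : ℝ → ℂ} (hS : Continuous S)
    (hmem : ∀ t ∈ Icc (0 : ℝ) 1, S t ∈ Ω) :
    ∃ T : ℝ → ℂ, ContDiff ℝ 1 T ∧ T 0 = S 0 ∧ T 1 = S 1 ∧ ∀ t ∈ Icc (0 : ℝ) 1, T t ∈ Ω := by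
  have hK : IsCompact (S '' Icc (0 : ℝ) 1) := isCompact_Icc.image hS
  obtain ⟨δ, hδ, hsub⟩ := hK.exists_thickening_subset_open hΩ (by
    rintro _ ⟨t, ht, rfl⟩; exact hmem t ht)
  obtain ⟨P, hP⟩ := exists_polynomial_near_of_continuousOn 0 1 (fun t => (S t).re)
    (by fun_prop) (δ / 6) (by positivity)
  obtain ⟨Q, hQ⟩ := exists_polynomial_near_of_continuousOn 0 1 (fun t => (S t).im)
    (by fun_prop) (δ / 6) (by positivity)
  set R : ℝ → ℂ := fun t => ((P.eval t : ℝ) : ℂ) + ((Q.eval t : ℝ) : ℂ) * Complex.I with hR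
  have hPc : ContDiff ℝ 1 fun t => P.eval t := P.contDiff_aeval 1
  have hQc : ContDiff ℝ 1 fun t => Q.eval t := Q.contDiff_aeval 1
  have hRc : ContDiff ℝ 1 R :=
    (Complex.ofRealCLM.contDiff.comp hPc).add
      ((Complex.ofRealCLM.contDiff.comp hQc).mul contDiff_const)
  have hnear : ∀ t ∈ Icc (0 : ℝ) 1, ‖R t - S t‖ < δ / 3 := by
    intro t ht
    have e : R t - S t = ((P.eval t - (S t).re : ℝ) : ℂ)
        + ((Q.eval t - (S t).im : ℝ) : ℂ) * Complex.I := by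
      conv_lhs => rw [← Complex.re_add_im (S t)]
      simp only [hR]; push_cast; ring
    rw [e]
    refine (norm_add_le _ _).trans_lt ?_
    rw [norm_mul, Complex.norm_I, mul_one, Complex.norm_real, Complex.norm_real, Real.norm_eq_abs,
      Real.norm_eq_abs]
    linarith [hP t ht, hQ t ht]
  -- The polynomial path `R` misses the end points by less than `δ / 3`; interpolating these errors
  -- affinely repairs them and keeps the path within `δ` of `S`.
  refine ⟨fun t => R t + (((1 - t : ℝ) : ℂ) * (S 0 - R 0) + (t : ℂ) * (S 1 - R 1)), ?_, by simp,
    by simp, fun t ht => hsub ?_⟩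
  · refine hRc.add (ContDiff.add ?_ ?_)
    · exact (Complex.ofRealCLM.contDiff.comp (contDiff_const.sub contDiff_id)).mul contDiff_const
    · exact Complex.ofRealCLM.contDiff.mul contDiff_const
  · refine Metric.mem_thickening_iff.mpr ⟨S t, mem_image_of_mem _ ht, ?_⟩
    rw [dist_eq_norm]
    have h0 := hnear 0 (by simp)
    have h1 := hnear 1 (by simp)
    rw [norm_sub_rev] at h0 h1
    have e : R t + (((1 - t : ℝ) : ℂ) * (S 0 - R 0) + (t : ℂ) * (S 1 - R 1)) - S t
        = (R t - S t) + (((1 - t : ℝ) : ℂ) * (S 0 - R 0) + (t : ℂ) * (S 1 - R 1)) := by ring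
    rw [e]
    calc _ ≤ ‖R t - S t‖ + (‖((1 - t : ℝ) : ℂ) * (S 0 - R 0)‖ + ‖(t : ℂ) * (S 1 - R 1)‖) :=
          (norm_add_le _ _).trans (by gcongr; exact norm_add_le _ _)
      _ < δ := by
          rw [norm_mul, norm_mul, Complex.norm_real, Complex.norm_real, Real.norm_of_nonneg ht.1,
            Real.norm_of_nonneg (sub_nonneg.mpr ht.2)]
          nlinarith [hnear t ht, mul_le_mul_of_nonneg_left h0.le (sub_nonneg.mpr ht.2),
            mul_le_mul_of_nonneg_left h1.le ht.1]

theorem hasDerivAt_coord {γ : ℝ → Cn 2} {t : ℝ} (h : DifferentiableAt ℝ γ t) (i : Fin 2) :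
    HasDerivAt (fun s => γ s i) (deriv γ t i) t :=
  (((EuclideanSpace.proj i : Cn 2 →L[ℂ] ℂ).restrictScalars ℝ).hasFDerivAt).comp_hasDerivAt t
    h.hasDerivAt

section Leaves

variable {n : Fin 2 → ℕ} {l : ℝ}

/-- The weighted vector field is `n 1` times the given one, so both span the same line. -/
theorem mem_tangentLine_iff (hn : ∀ i, 0 < n i) (hl : 0 < l) (h : l = (n 0 : ℝ) / n 1)
    {z v : Cn 2} :
    v ∈ tangentLine (linFoliation l hl) z ↔ ∃ c : ℂ, ∀ i, v i = c * (n i * z i) := by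
  have h1 : ((n 1 : ℕ) : ℂ) ≠ 0 := by exact_mod_cast (hn 1).ne'
  have h2 : (l : ℂ) = (n 0 : ℂ) / n 1 := by rw [h]; push_cast; rfl
  constructor
  · rintro ⟨c, rfl⟩
    refine ⟨c / n 1, fun i => ?_⟩
    fin_cases i
    · simp [linFoliation, h2]; ring
    · simp [linFoliation]; field_simp
  · rintro ⟨c, hc⟩
    refine ⟨c * n 1, ?_⟩
    ext i
    rw [hc i]
    fin_cases i
    · simp [linFoliation, h2]; field_simp
    · simp [linFoliation]; ring

/-- A `C¹` path tangent to the weighted vector field is a reparametrized orbit. -/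
theorem exists_time_of_tangent (hn : ∀ i, 0 < n i) {γ : ℝ → Cn 2} (hγ : ContDiff ℝ 1 γ)
    (h : ∀ t ∈ Icc (0 : ℝ) 1, γ t ≠ 0 ∧ ∃ c : ℂ, ∀ i, deriv γ t i = c * (n i * γ t i)) :
    ∃ S : ℝ → ℂ, Continuous S ∧ S 0 = 0 ∧
      ∀ t ∈ Icc (0 : ℝ) 1, γ t = wflow n (S t) (γ 0) := by
  have hd : Continuous (deriv γ) := hγ.continuous_deriv le_rfl
  have hγc := hγ.continuous
  -- The factor of proportionality is written as a Hermitian projection, which shows that it is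
  -- continuous. Its integral is the required time.
  set c : ℝ → ℂ := fun t => (∑ i, (starRingEnd ℂ) (n i * γ t i) * deriv γ t i) /
    (∑ i, (starRingEnd ℂ) (n i * γ t i) * (n i * γ t i)) with hc
  have hden : ∀ t ∈ Icc (0 : ℝ) 1,
      (∑ i, (starRingEnd ℂ) (n i * γ t i) * (n i * γ t i)) ≠ 0 := by
    intro t ht h0
    obtain ⟨i, hi⟩ := Cn.ne_zero_iff.mp (h t ht).1
    have e : (∑ i, (starRingEnd ℂ) (n i * γ t i) * (n i * γ t i))
        = ((∑ i, ‖(n i * γ t i : ℂ)‖ ^ 2 : ℝ) : ℂ) := by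
      push_cast
      exact Finset.sum_congr rfl fun i _ => Complex.conj_mul' _
    rw [e, Complex.ofReal_eq_zero, Finset.sum_eq_zero_iff_of_nonneg (fun _ _ => by positivity)]
      at h0
    have := h0 i (Finset.mem_univ i)
    simp [hi, (hn i).ne'] at this
  have hcc : ContinuousOn c (Icc 0 1) := by
    refine ContinuousOn.div ?_ ?_ hden <;> fun_prop
  have hcd : ∀ t ∈ Icc (0 : ℝ) 1, ∀ i, deriv γ t i = c t * (n i * γ t i) := by
    intro t ht i
    obtain ⟨a, ha⟩ := (h t ht).2
    have : c t = a := by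
      simp only [hc]
      rw [div_eq_iff (hden t ht), Finset.mul_sum]
      refine Finset.sum_congr rfl fun j _ => ?_
      rw [ha j]; ring
    rw [this]; exact ha i
  set C : ℝ → ℂ := IccExtend (zero_le_one' ℝ) ((Icc (0 : ℝ) 1).domRestrict c) with hC
  have hCc : Continuous C := (continuousOn_iff_continuous_domRestrict.mp hcc).Icc_extend'
  have hCe : ∀ t ∈ Icc (0 : ℝ) 1, C t = c t := fun t ht => by
    simp only [hC]; rw [IccExtend_of_mem _ _ ht]; rfl
  have hS : ∀ t, HasDerivAt (fun t => ∫ u in (0 : ℝ)..t, C u) (C t) t := fun t =>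
    intervalIntegral.integral_hasDerivAt_right (hCc.intervalIntegrable _ _)
      hCc.stronglyMeasurable.stronglyMeasurableAtFilter hCc.continuousAt
  refine ⟨fun t => ∫ u in (0 : ℝ)..t, C u,
    continuous_iff_continuousAt.mpr fun t => (hS t).continuousAt, by simp, fun t ht => ?_⟩
  ext i
  -- Flowing back by the integrated time makes every coordinate constant.
  have hder : ∀ u ∈ Icc (0 : ℝ) 1, HasDerivAt
      (fun u => γ u i * Complex.exp (-(n i * ∫ u in (0 : ℝ)..u, C u))) 0 u := by
    intro u hu
    have h1 := hasDerivAt_coord (hγ.differentiable one_ne_zero u) i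
    have h2 := (((hS u).const_mul (n i : ℂ)).neg).cexp
    refine (h1.mul h2).congr_deriv ?_
    rw [hcd u hu i, hCe u hu]
    simp only [Pi.neg_apply]
    ring
  have := constant_of_has_deriv_right_zero
    (f := fun u => γ u i * Complex.exp (-(n i * ∫ u in (0 : ℝ)..u, C u)))
    (fun u hu => (hder u hu).continuousAt.continuousWithinAt)
    (fun u hu => (hder u (Ico_subset_Icc_self hu)).hasDerivWithinAt) t ht
  simp only [intervalIntegral.integral_same, mul_zero, neg_zero, Complex.exp_zero, mul_one] at this
  rw [wflow_apply, ← this, mul_left_comm, ← Complex.exp_add]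
  simp

theorem wflow_tangent {S : ℝ → ℂ} (hS : ContDiff ℝ 1 S) (z : Cn 2) :
    ContDiff ℝ 1 (fun t => wflow n (S t) z) ∧
      ∀ t i, deriv (fun t => wflow n (S t) z) t i = deriv S t * (n i * wflow n (S t) z i) := by
  have h : ContDiff ℝ 1 (fun t => wflow n (S t) z) := by
    rw [contDiff_piLp]
    intro i
    exact ((contDiff_const.mul hS).cexp).mul contDiff_const
  refine ⟨h, fun t i => ?_⟩
  have h1 := hasDerivAt_coord (h.differentiable one_ne_zero t) i
  have h2 := ((((hS.differentiable one_ne_zero t).hasDerivAt).const_mul (n i : ℂ)).cexp).mul_const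
    (z i)
  refine (h1.unique h2).trans ?_
  simp only [wflow_apply]
  ring

/-- The leaves of the foliation on an open set. -/
theorem mem_leaf_iff (hn : ∀ i, 0 < n i) (hl : 0 < l) (h : l = (n 0 : ℝ) / n 1) {V : Set (Cn 2)}
    (hV : IsOpen V) {z w : Cn 2} (hz : z ≠ 0) :
    w ∈ (linFoliation l hl).leaf V z ↔ ∃ S : ℝ → ℂ, Continuous S ∧ S 0 = 0 ∧
      wflow n (S 1) z = w ∧ ∀ t ∈ Icc (0 : ℝ) 1, wflow n (S t) z ∈ V := by
  constructor
  · rintro ⟨γ, hγ, rfl, rfl, hmem⟩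
    obtain ⟨S, hS, hS0, hSt⟩ := exists_time_of_tangent hn hγ (fun t ht =>
      ⟨(hmem t ht).1.2, (mem_tangentLine_iff hn hl h).mp (hmem t ht).2⟩)
    exact ⟨S, hS, hS0, (hSt 1 (by simp)).symm, fun t ht => hSt t ht ▸ (hmem t ht).1.1⟩
  · rintro ⟨S, hS, hS0, rfl, hmem⟩
    -- The times that keep `z` in `V` form an open set, so the continuous time may be replaced by a
    -- `C¹` one.
    obtain ⟨T, hT, hT0, hT1, hTm⟩ := exists_contDiff_path
      (hV.preimage (f := fun s => wflow n s z) (by fun_prop)) hS hmem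
    obtain ⟨h1, h2⟩ := wflow_tangent (n := n) hT z
    exact ⟨_, h1, by simp [hT0, hS0], by simp [hT1], fun t ht =>
      ⟨⟨hTm t ht, wflow_ne_zero hz⟩, (mem_tangentLine_iff hn hl h).mpr ⟨_, h2 t⟩⟩⟩

theorem sphere_point_ne_zero (z : Sph 2) : (z : Cn 2) ≠ 0 := by
  rintro h
  have := z.2
  rw [h] at this
  simp at this

/-- The flow of the trace foliation on the sphere. -/
noncomputable def sflow (n : Fin 2 → ℕ) (t : ℝ) (z : Sph 2) : Sph 2 :=
  ⟨wflow n (t * Complex.I) z, by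
    rw [mem_sphere_zero_iff_norm, norm_wflow_mul_I]; exact mem_sphere_zero_iff_norm.mp z.2⟩

@[simp] theorem coe_sflow (t : ℝ) (z : Sph 2) :
    (sflow n t z : Cn 2) = wflow n (t * Complex.I) z := rfl

@[fun_prop]
theorem Continuous.sflow {X : Type*} [TopologicalSpace X] {s : X → ℝ} {z : X → Sph 2}
    (hs : Continuous s) (hz : Continuous z) : Continuous fun x => sflow n (s x) (z x) := by
  refine Continuous.subtype_mk ?_ _
  fun_prop

theorem sflow_add (s t : ℝ) (z : Sph 2) : sflow n (s + t) z = sflow n s (sflow n t z) := by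
  ext1; simp [add_mul, wflow_add]

@[simp] theorem sflow_zero_time (z : Sph 2) : sflow n 0 z = z := by
  ext1; simp

/-- The trace leaves are the orbits of the flow on the sphere. -/
theorem traceLeaf_eq (hn : ∀ i, 0 < n i) (hl : 0 < l) (h : l = (n 0 : ℝ) / n 1) (z : Sph 2) :
    (linFoliation l hl).traceLeaf z = range fun t => sflow n t z := by
  have hz := sphere_point_ne_zero z
  ext w
  constructor
  · rintro ⟨γ, hγ, h0, h1, hmem⟩
    have hne : ∀ t ∈ Icc (0 : ℝ) 1, γ t ≠ 0 := fun t ht =>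
      sphere_point_ne_zero ⟨γ t, (hmem t ht).1⟩
    obtain ⟨S, hS, hS0, hSt⟩ := exists_time_of_tangent hn hγ (fun t ht =>
      ⟨hne t ht, (mem_tangentLine_iff hn hl h).mp (hmem t ht).2.1⟩)
    have e := hSt 1 (by simp)
    rw [h0, h1] at e
    -- Both end points lie on the sphere and the norm is strictly monotone in the real part of the
    -- time.
    have hre : (S 1).re = 0 := re_eq_zero_of_norm_wflow_eq hn hz (by
      rw [← e, mem_sphere_zero_iff_norm.mp w.2, mem_sphere_zero_iff_norm.mp z.2])
    refine ⟨(S 1).im, Subtype.ext ?_⟩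
    rw [coe_sflow, e]
    congr 1
    apply Complex.ext <;> simp [hre]
  · rintro ⟨s, rfl⟩
    have hT : ContDiff ℝ 1 (fun t : ℝ => ((t * s : ℝ) : ℂ) * Complex.I) :=
      (Complex.ofRealCLM.contDiff.comp (contDiff_id.mul contDiff_const)).mul contDiff_const
    have hderiv : ∀ t, deriv (fun t : ℝ => ((t * s : ℝ) : ℂ) * Complex.I) t = s * Complex.I := by
      intro t
      have : HasDerivAt (fun t : ℝ => ((t * s : ℝ) : ℂ) * Complex.I)
          (((1 * s : ℝ) : ℂ) * Complex.I) t :=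
        (((hasDerivAt_id t).mul_const s).ofReal_comp).mul_const Complex.I
      simpa using this.deriv
    obtain ⟨h1, h2⟩ := wflow_tangent (n := n) hT (z : Cn 2)
    refine ⟨_, h1, by simp, by simp, fun t _ => ⟨?_, ?_, ?_⟩⟩
    · exact (sflow n (t * s) z).2
    · exact (mem_tangentLine_iff hn hl h).mpr ⟨_, h2 t⟩
    · rw [PiLp.inner_apply, Complex.re_sum]
      refine Finset.sum_eq_zero fun i _ => ?_
      rw [h2 t i, hderiv]
      set a := wflow n (((t * s : ℝ) : ℂ) * Complex.I) (z : Cn 2) i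
      have : inner ℂ a (↑s * Complex.I * (↑(n i) * a))
          = ((s * n i * ‖a‖ ^ 2 : ℝ) : ℂ) * Complex.I := by
        rw [RCLike.inner_apply]
        push_cast
        rw [← Complex.mul_conj']; ring
      rw [this, Complex.re_ofReal_mul, Complex.I_re, mul_zero]

end Leaves

/-! ### Topological equivalence of germs -/

/-- A continuous logarithm of a path close to `1` is the principal one. -/
theorem eq_log_of_exp_mem_slitPlane {f : ℝ → ℂ} (hf : Continuous f) (h0 : f 0 = 0)
    (h : ∀ s ∈ Icc (0 : ℝ) 1, Complex.exp (f s) ∈ Complex.slitPlane) :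
    f 1 = Complex.log (Complex.exp (f 1)) := by
  have hp : Continuous fun s : ℝ => ((projIcc (0 : ℝ) 1 zero_le_one s : Icc (0 : ℝ) 1) : ℝ) := by
    fun_prop
  have h1 := eq_of_exp_eq (f := fun s => f (projIcc (0 : ℝ) 1 zero_le_one s))
    (g := fun s => Complex.log (Complex.exp (f (projIcc (0 : ℝ) 1 zero_le_one s))))
    (hf.comp hp) ((Complex.continuous_exp.comp (hf.comp hp)).clog fun s => h _ (Subtype.prop _))
    (fun s => (Complex.exp_log (Complex.exp_ne_zero _)).symm) (by simp [h0]) 1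
  simpa using h1

theorem continuous_comp_projIcc {X : Type*} [TopologicalSpace X] {c : ℝ → X}
    (hc : ContinuousOn c (Icc 0 1)) :
    Continuous fun s => c (projIcc (0 : ℝ) 1 zero_le_one s) :=
  (continuousOn_iff_continuous_domRestrict.mp hc).comp continuous_projIcc

/-- The order of the holonomy of the complex leaf through a point. -/
noncomputable def leafOrder (n : Fin 2 → ℕ) (z : Cn 2) : ℕ :=
  if z 0 = 0 then n 1 else if z 1 = 0 then n 0 else 1

section Germs

variable {n n' : Fin 2 → ℕ} {l l' : ℝ}

theorem leafOrder_mul_period (hc : (n 0).Coprime (n 1)) {z : Cn 2} (hz : z ≠ 0) {s : ℂ}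
    (h : wflow n s z = z) :
    ∃ k : ℤ, (leafOrder n z : ℂ) * s = k * (2 * Real.pi * Complex.I) := by
  unfold leafOrder
  split_ifs with h0 h1
  · obtain ⟨i, hi⟩ := Cn.ne_zero_iff.mp hz
    fin_cases i
    · exact absurd h0 hi
    · exact Complex.exp_eq_one_iff.mp (exp_eq_one_of_wflow_eq_self h hi)
  · exact Complex.exp_eq_one_iff.mp (exp_eq_one_of_wflow_eq_self h h0)
  · simpa using exists_int_of_wflow_eq_self hc h (Fin.forall_fin_two.mpr ⟨h0, h1⟩)

theorem leaf_subset (F : Foliation 2) (V : Set (Cn 2)) (z : Cn 2) : F.leaf V z ⊆ V := by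
  rintro w ⟨γ, -, -, rfl, h⟩
  exact (h 1 (by simp)).1.1

theorem ne_zero_of_mem_leaf {F : Foliation 2} {V : Set (Cn 2)} {z w : Cn 2}
    (h : w ∈ F.leaf V z) : z ≠ 0 := by
  obtain ⟨γ, -, rfl, -, h⟩ := h
  exact (h 0 (by simp)).1.2

theorem exists_time_of_mem_leaf (hn : ∀ i, 0 < n i) (hl : 0 < l) (h : l = (n 0 : ℝ) / n 1)
    {V : Set (Cn 2)} (hV : IsOpen V) {z w : Cn 2} (hw : w ∈ (linFoliation l hl).leaf V z) :
    ∃ s, w = wflow n s z := by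
  obtain ⟨S, -, -, h1, -⟩ := (mem_leaf_iff hn hl h hV (ne_zero_of_mem_leaf hw)).mp hw
  exact ⟨S 1, h1.symm⟩

/-- Following a loop in a leaf as often as the order of the leaf gives trivial holonomy. -/
theorem isHolonomy_id_leafOrder (hn : ∀ i, 0 < n i) (hc : (n 0).Coprime (n 1)) (hl : 0 < l)
    (h : l = (n 0 : ℝ) / n 1) {V : Set (Cn 2)} (hV : IsOpen V) {γ : ℝ → Cn 2}
    (hγ : Continuous γ) (hper : ∀ t, γ (t + 1) = γ t)
    (hleaf : ∀ t, γ t ∈ (linFoliation l hl).leaf V (γ 0)) :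
    IsHolonomy ((linFoliation l hl).leaf V) V (fun t => γ (leafOrder n (γ 0) * t)) id := by
  have hz : γ 0 ≠ 0 := ne_zero_of_mem_leaf (hleaf 0)
  obtain ⟨S, hS, hS0, hSt⟩ := exists_continuous_time hn hγ hz
    (fun t => exists_time_of_mem_leaf hn hl h hV (hleaf t)) (s₀ := 0) (by simp)
  have hper1 : wflow n (S 1) (γ 0) = γ 0 := by rw [← hSt 1, ← hper 0, zero_add]
  obtain ⟨i, hi⟩ := Cn.ne_zero_iff.mp hz
  have hni : ((n i : ℕ) : ℂ) ≠ 0 := by exact_mod_cast (hn i).ne'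
  -- After multiplication by `n i`, both sides are continuous logarithms of the same function with
  -- the same value at `0`.
  have hstep : ∀ t, S (t + 1) = S t + S 1 := by
    intro t
    have h1 := eq_of_exp_eq (f := fun t => n i * S (t + 1)) (g := fun t => n i * (S t + S 1))
      (by fun_prop) (by fun_prop) (fun t => by
        rw [mul_add, Complex.exp_add, exp_eq_one_of_wflow_eq_self hper1 hi, mul_one]
        have e := congrArg (fun w : Cn 2 => w i) (hper t)
        rw [hSt (t + 1), hSt t] at e
        exact mul_right_cancel₀ hi e) (by simp [hS0]) t
    exact mul_left_cancel₀ hni h1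
  have hmul : ∀ k : ℕ, S k = k * S 1 := by
    intro k
    induction k with
    | zero => simp [hS0]
    | succ k ih => push_cast; rw [hstep, ih]; ring
  set k := leafOrder n (γ 0) with hk
  -- `S k = k * S 1` lies in `2πiℤ`, hence is a period of every point and not only of `γ 0`.
  have hSk : ∀ z, wflow n (S k) z = z := by
    obtain ⟨m, hm⟩ := leafOrder_mul_period hc hz hper1
    intro z
    rw [hmul k, hm, wflow_int_period]
  have hev : ∀ᶠ z in 𝓝 (γ 0), ∀ s ∈ Icc (0 : ℝ) 1, wflow n (S (k * s)) z ∈ V := by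
    refine isCompact_Icc.eventually_forall_of_forall_eventually fun s _ => ?_
    have hcont : Continuous fun p : Cn 2 × ℝ => wflow n (S (k * p.2)) p.1 := by fun_prop
    refine hcont.continuousAt.eventually_mem (hV.mem_nhds ?_)
    rw [← hSt]
    exact leaf_subset _ _ _ (hleaf _)
  have hN := hev.and (isOpen_ne.mem_nhds hz)
  have hN' : {z : Cn 2 | (∀ s ∈ Icc (0 : ℝ) 1, wflow n (S (k * s)) z ∈ V) ∧ z ≠ 0} ∈
      𝓝[V] (γ (k * (0 : ℝ))) := by
    rw [mul_zero]; exact mem_nhdsWithin_of_mem_nhds hN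
  refine ⟨_, ?_, hN', fun p => wflow n (S (k * p.2)) p.1,
    Continuous.continuousOn (by fun_prop), ?_, ?_⟩
  · rintro z ⟨hzV, -⟩
    simpa [hS0] using hzV 0 (by simp)
  · intro s _
    simp [← hSt]
  · rintro z ⟨hzV, hz0⟩
    refine ⟨by simp [hS0], by simp [hSk], by simpa [hS0] using hzV 0 (by simp), fun s hs => ?_⟩
    refine (mem_leaf_iff hn hl h hV hz0).mpr ⟨fun u => S (k * (u * s)), by fun_prop, by simp [hS0],
      by simp, fun u hu => hzV _ ⟨mul_nonneg hu.1 hs.1, mul_le_one₀ hu.2 hs.1 hs.2⟩⟩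

theorem exists_time_of_isHolonomy (hn : ∀ i, 0 < n i) (hl : 0 < l) (h : l = (n 0 : ℝ) / n 1)
    {V : Set (Cn 2)} (hV : IsOpen V) {N : Set (Cn 2)} {H : Cn 2 × ℝ → Cn 2}
    (hH : ContinuousOn H (N ×ˢ Icc 0 1)) {z : Cn 2} (hz : z ∈ N) (hz0 : H (z, 0) = z)
    (hleaf : ∀ s ∈ Icc (0 : ℝ) 1, H (z, s) ∈ (linFoliation l hl).leaf V z) :
    ∃ S : ℝ → ℂ, Continuous S ∧ S 0 = 0 ∧ ∀ s ∈ Icc (0 : ℝ) 1, H (z, s) = wflow n (S s) z := by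
  have hcont : ContinuousOn (fun s => H (z, s)) (Icc 0 1) :=
    hH.comp (by fun_prop) fun s hs => ⟨hz, hs⟩
  obtain ⟨S, hS, hS0, hSt⟩ := exists_continuous_time hn (continuous_comp_projIcc hcont)
    (ne_zero_of_mem_leaf (hleaf 0 (by simp)))
    (fun t => exists_time_of_mem_leaf hn hl h hV (hleaf _ (Subtype.prop _))) (s₀ := 0)
    (by simp [hz0])
  refine ⟨S, hS, hS0, fun s hs => ?_⟩
  rw [← hSt s, projIcc_of_mem zero_le_one hs]

/-- If the holonomy along a `k`-fold circle in a coordinate axis is trivial, then `k` is a multiple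
of the weight of the axis. -/
theorem dvd_of_isHolonomy_id (hn : ∀ i, 0 < n i) (hc : (n 0).Coprime (n 1)) (hl : 0 < l)
    (h : l = (n 0 : ℝ) / n 1) {V : Set (Cn 2)} (hV : IsOpen V) {i : Fin 2} {r : ℝ} (hr : 0 < r)
    (hrV : EuclideanSpace.single i (r : ℂ) ∈ V) {k : ℕ}
    (hhol : IsHolonomy ((linFoliation l hl).leaf V) V (fun t => EuclideanSpace.single i
      (r * Complex.exp (2 * Real.pi * Complex.I * (k * t)))) id) : n i ∣ k := by
  obtain ⟨N, hNV, hN, H, hH, hγ, hN2⟩ := hhol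
  simp only [Complex.ofReal_zero, mul_zero, Complex.exp_zero, mul_one] at hN hγ
  set x : Cn 2 := EuclideanSpace.single i (r : ℂ) with hx
  have hxN : x ∈ N := mem_of_mem_nhdsWithin hrV hN
  rw [hV.nhdsWithin_eq hrV] at hN
  obtain ⟨v, hv, hvu⟩ := isCompact_Icc.mem_uniformity_of_prod (f := fun z s => H (z, s) i)
    (s := N) (k := Icc (0 : ℝ) 1) (q := x) (u := {p | dist p.1 p.2 < r})
    ((by fun_prop : Continuous fun w : Cn 2 => w i).comp_continuousOn hH) hxN
    (Metric.dist_mem_uniformity hr)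
  rw [nhdsWithin_eq_nhds.mpr hN] at hv
  have htend : Tendsto (fun ε : ℝ => x + (WithLp.toLp 2 fun _ => (ε : ℂ) : Cn 2)) (𝓝[>] 0)
      (𝓝 x) := by
    have : Continuous (fun ε : ℝ => x + (WithLp.toLp 2 fun _ => (ε : ℂ) : Cn 2)) :=
      continuous_const.add ((PiLp.continuous_toLp 2 _).comp (continuous_pi fun _ => by fun_prop))
    have h0 : x + (WithLp.toLp 2 fun _ => ((0 : ℝ) : ℂ) : Cn 2) = x := by ext j; simp
    simpa only [h0] using (this.tendsto 0).mono_left nhdsWithin_le_nhds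
  obtain ⟨ε, hε, hε0⟩ :=
    ((htend.eventually (inter_mem hv hN)).and self_mem_nhdsWithin).exists
  replace hε0 : 0 < ε := hε0
  -- A nearby point off both axes, whose periods are only the multiples of `2πi`; shifting both
  -- coordinates by `ε > 0` treats both axes at once.
  set z : Cn 2 := x + (WithLp.toLp 2 fun _ => (ε : ℂ) : Cn 2) with hzdef
  have hzi : z i = ((r + ε : ℝ) : ℂ) := by simp [hzdef, hx]
  have hzne : ∀ j, z j ≠ 0 := by
    intro j
    by_cases hj : j = i
    · subst hj; rw [hzi]; exact Complex.ofReal_ne_zero.mpr (add_pos hr hε0).ne'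
    · simp [hzdef, hx, hj, hε0.ne']
  obtain ⟨h0, h1, -, hleaf⟩ := hN2 z hε.2
  obtain ⟨S, hS, hS0, hSt⟩ := exists_time_of_isHolonomy hn hl h hV hH hε.2 h0 hleaf
  obtain ⟨m, hm⟩ := exists_int_of_wflow_eq_self hc (s := S 1) (z := z)
    (by rw [← hSt 1 (by simp), h1]; rfl) hzne
  -- The lifted angle between the nearby loop and the `k`-fold circle. If it never leaves the slit
  -- plane, the two loops wind equally often, so `f 1 = 0` and `n i * m = k`.
  set f : ℝ → ℂ := fun s => n i * S s - 2 * Real.pi * Complex.I * (k * s) with hf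
  have hslit : ∀ s ∈ Icc (0 : ℝ) 1, Complex.exp (f s) ∈ Complex.slitPlane := by
    intro s hs
    have hd : dist (H (z, s) i) (H (x, s) i) < r := hvu z hε.1 s hs
    rw [hγ s hs, hSt s hs, wflow_apply, hzi, dist_eq_norm] at hd
    set E := Complex.exp (2 * Real.pi * Complex.I * (k * s)) with hE
    have hE0 : E ≠ 0 := Complex.exp_ne_zero _
    have hE1 : ‖E‖ = 1 := by
      rw [hE, show (2 * Real.pi * Complex.I * (k * s) : ℂ)
        = ((2 * Real.pi * (k * s) : ℝ) : ℂ) * Complex.I by push_cast; ring]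
      exact Complex.norm_exp_ofReal_mul_I _
    have e : Complex.exp (n i * S s) * ((r + ε : ℝ) : ℂ) - EuclideanSpace.single i (r * E) i
        = E * (((r + ε : ℝ) : ℂ) * Complex.exp (f s) - r) := by
      simp only [hf, Complex.exp_sub, ← hE, PiLp.single_apply, if_true]
      field_simp
    -- The open disc of radius `r` around `r` lies in the right half-plane, so `exp (f s)` has
    -- positive real part.
    rw [e, norm_mul, hE1, one_mul] at hd
    have h2 := (Complex.abs_re_le_norm _).trans_lt hd
    rw [Complex.sub_re, Complex.re_ofReal_mul, Complex.ofReal_re, abs_lt] at h2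
    left
    by_contra hneg
    nlinarith
  have hf1 : f 1 = ((n i * m - k : ℤ) : ℂ) * (2 * Real.pi * Complex.I) := by
    simp only [hf, hm]; push_cast; ring
  have := eq_log_of_exp_mem_slitPlane (f := f) (by fun_prop) (by simp [hf, hS0]) hslit
  rw [Complex.exp_eq_one_iff.mpr ⟨_, hf1⟩, Complex.log_one, hf1] at this
  have h2 : ((n i * m - k : ℤ) : ℂ) = 0 := by simpa using this
  have h3 : (n i * m - k : ℤ) = 0 := by exact_mod_cast h2
  exact Int.natCast_dvd_natCast.mp ⟨m, by linarith⟩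

/-- `φ` maps the leaves of `F` in its source onto the leaves of `G` in its target. -/
structure LeafEquiv (φ : OpenPartialHomeomorph (Cn 2) (Cn 2)) (F G : Foliation 2) : Prop where
  zero_mem : (0 : Cn 2) ∈ φ.source
  map_zero : φ 0 = 0
  image_leaf : ∀ p ∈ φ.source, p ≠ 0 → φ '' F.leaf φ.source p = G.leaf φ.target (φ p)

namespace LeafEquiv

variable {φ : OpenPartialHomeomorph (Cn 2) (Cn 2)} {F G : Foliation 2}

theorem map_ne_zero (hφ : LeafEquiv φ F G) {p : Cn 2} (hp : p ∈ φ.source) (h : p ≠ 0) :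
    φ p ≠ 0 := fun h0 => h (φ.injOn hp hφ.zero_mem (h0.trans hφ.map_zero.symm))

theorem symm (hφ : LeafEquiv φ F G) : LeafEquiv φ.symm G F where
  zero_mem := by
    rw [φ.symm_source, ← hφ.map_zero]; exact φ.map_source hφ.zero_mem
  map_zero := by
    conv_lhs => rw [← hφ.map_zero]
    exact φ.left_inv hφ.zero_mem
  image_leaf := by
    intro p hp hp0
    rw [φ.symm_source] at hp
    have h0 : φ.symm p ≠ 0 := fun h => hp0 (by rw [← φ.right_inv hp, h, hφ.map_zero])
    have h1 := hφ.image_leaf _ (φ.map_target hp) h0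
    rw [φ.right_inv hp] at h1
    rw [φ.symm_source, φ.symm_target, ← h1]
    exact φ.symm_image_image_of_subset_source (leaf_subset _ _ _)

theorem map_mem_leaf (hφ : LeafEquiv φ F G) {p q : Cn 2} (hp : p ∈ φ.source)
    (hq : q ∈ F.leaf φ.source p) : φ q ∈ G.leaf φ.target (φ p) := by
  rw [← hφ.image_leaf p hp (ne_zero_of_mem_leaf hq)]
  exact mem_image_of_mem _ hq

theorem isHolonomy_id (hφ : LeafEquiv φ F G) {γ : ℝ → Cn 2} (hγ : γ 0 ∈ φ.source)
    (h : IsHolonomy (F.leaf φ.source) φ.source γ id) :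
    IsHolonomy (G.leaf φ.target) φ.target (fun t => φ (γ t)) id := by
  obtain ⟨N, hNs, hN, H, hH, hHγ, hH2⟩ := h
  have hsymm : MapsTo φ.symm (φ '' N) N := by
    rintro _ ⟨z, hz, rfl⟩
    rwa [φ.left_inv (hNs hz)]
  refine ⟨φ '' N, ?_, ?_, fun p => φ (H (φ.symm p.1, p.2)), ?_, ?_, ?_⟩
  · rintro _ ⟨z, hz, rfl⟩
    exact φ.map_source (hNs hz)
  · rw [φ.open_source.nhdsWithin_eq hγ] at hN
    exact mem_nhdsWithin_of_mem_nhds (φ.image_mem_nhds hγ hN)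
  · refine φ.continuousOn.comp (hH.comp ?_ ?_) ?_
    · refine ContinuousOn.prodMk (φ.continuousOn_symm.comp continuousOn_fst ?_) continuousOn_snd
      rintro ⟨_, s⟩ ⟨⟨z, hz, rfl⟩, -⟩
      exact φ.map_source (hNs hz)
    · rintro ⟨w, s⟩ ⟨hw, hs⟩
      exact ⟨hsymm hw, hs⟩
    · rintro ⟨w, s⟩ ⟨hw, hs⟩
      exact leaf_subset _ _ _ ((hH2 _ (hsymm hw)).2.2.2 s hs)
  · intro s hs
    simp only [φ.left_inv hγ, hHγ s hs]
  · rintro _ ⟨z, hz, rfl⟩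
    obtain ⟨h0, h1, h2, h3⟩ := hH2 z hz
    simp only [φ.left_inv (hNs hz)]
    exact ⟨by rw [h0], by rw [h1]; rfl, φ.map_source h2, fun s hs =>
      hφ.map_mem_leaf (hNs hz) (h3 s hs)⟩

end LeafEquiv

theorem wflow_single (s : ℂ) (i : Fin 2) (a : ℂ) : wflow n s (EuclideanSpace.single i a)
    = EuclideanSpace.single i (Complex.exp (n i * s) * a) := by
  ext j
  by_cases hj : j = i
  · subst hj; simp
  · simp [hj]

/-- The image of a circle in the `i`-th axis is a loop in a leaf, and following it `leafOrder` times
gives trivial holonomy. Pulled back by `φ`, this says the same of the multiple circle, to which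
`dvd_of_isHolonomy_id` applies. -/
theorem leafOrder_map_dvd {φ : OpenPartialHomeomorph (Cn 2) (Cn 2)} (hn : ∀ i, 0 < n i)
    (hc : (n 0).Coprime (n 1)) (hl : 0 < l) (h : l = (n 0 : ℝ) / n 1) (hn' : ∀ i, 0 < n' i)
    (hc' : (n' 0).Coprime (n' 1)) (hl' : 0 < l') (h' : l' = (n' 0 : ℝ) / n' 1)
    (hφ : LeafEquiv φ (linFoliation l hl) (linFoliation l' hl')) {i : Fin 2} {r : ℝ} (hr : 0 < r)
    (hrs : ∀ w : ℂ, ‖w‖ = r → EuclideanSpace.single i w ∈ φ.source) :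
    n i ∣ leafOrder n' (φ (EuclideanSpace.single i (r : ℂ))) := by
  set c : ℝ → Cn 2 := fun t =>
    EuclideanSpace.single i (r * Complex.exp (2 * Real.pi * Complex.I * t)) with hcdef
  have hni : ((n i : ℕ) : ℂ) ≠ 0 := by exact_mod_cast (hn i).ne'
  have hexp : ∀ t : ℝ, ‖Complex.exp (2 * Real.pi * Complex.I * t)‖ = 1 := fun t => by
    rw [show (2 * Real.pi * Complex.I * t : ℂ)
      = ((2 * Real.pi * t : ℝ) : ℂ) * Complex.I by push_cast; ring]
    exact Complex.norm_exp_ofReal_mul_I _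
  have hcs : ∀ t, c t ∈ φ.source := fun t => hrs _ (by
    rw [norm_mul, hexp, mul_one, Complex.norm_real, Real.norm_of_nonneg hr.le])
  have hc0 : c 0 = EuclideanSpace.single i (r : ℂ) := by simp [hcdef]
  have hccont : Continuous c := by
    refine (PiLp.continuous_toLp 2 _).comp (continuous_pi fun j => ?_)
    by_cases hj : j = i
    · subst hj; simp only [Pi.single_eq_same]; fun_prop
    · simp only [Pi.single_eq_of_ne hj]; fun_prop
  have hcleaf : ∀ t, c t ∈ (linFoliation l hl).leaf φ.source (c 0) := by
    intro t
    have hflow : ∀ u : ℝ, wflow n (2 * Real.pi * Complex.I * (u * t) / n i) (c 0) = c (u * t) := by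
      intro u
      have e : (n i * (2 * Real.pi * Complex.I * (u * t) / n i) : ℂ)
          = 2 * Real.pi * Complex.I * ((u * t : ℝ) : ℂ) := by push_cast; field_simp
      rw [hc0, wflow_single, e, mul_comm]
    refine (mem_leaf_iff hn hl h φ.open_source ?_).mpr
      ⟨fun u => 2 * Real.pi * Complex.I * (u * t) / n i, by fun_prop, by simp, ?_, fun u _ => ?_⟩
    · rw [hc0, Cn.ne_zero_iff]
      exact ⟨i, by simp [hr.ne']⟩
    · simp only [hflow, one_mul]
    · simp only [hflow]
      exact hcs _
  have hhol := isHolonomy_id_leafOrder hn' hc' hl' h' φ.open_target (γ := fun t => φ (c t))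
    (φ.continuousOn.comp_continuous hccont hcs) (fun t => by
      have : c (t + 1) = c t := by
        simp only [hcdef]
        congr 2
        push_cast
        rw [mul_add, Complex.exp_add, mul_one, Complex.exp_two_pi_mul_I, mul_one]
      simp only [this]) (fun t => hφ.map_mem_leaf (hcs 0) (hcleaf t))
  have hhol' := hφ.symm.isHolonomy_id (by simpa using φ.map_source (hcs 0)) hhol
  simp only [φ.symm_target, φ.left_inv (hcs _)] at hhol'
  rw [← hc0]
  refine dvd_of_isHolonomy_id hn hc hl h φ.open_source hr (hc0 ▸ hcs 0) ?_
  simpa [hcdef] using hhol'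

/-- The point lies in the `i`-th coordinate axis. -/
def OnAxis (i : Fin 2) (z : Cn 2) : Prop := ∀ j, j ≠ i → z j = 0

theorem OnAxis.eq_single {i : Fin 2} {z : Cn 2} (h : OnAxis i z) :
    z = EuclideanSpace.single i (z i) := by
  ext j
  by_cases hj : j = i
  · subst hj; simp
  · simp [hj, h j hj]

theorem OnAxis.unique {i j : Fin 2} {z : Cn 2} (hi : OnAxis i z) (hj : OnAxis j z) (hz : z ≠ 0) :
    i = j := by
  by_contra hij
  refine hz ?_
  ext k
  by_cases hk : k = i
  · subst hk; exact hj _ hij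
  · exact hi k hk

theorem OnAxis.leafOrder {i : Fin 2} {z : Cn 2} (h : OnAxis i z) (hz : z ≠ 0) :
    leafOrder n z = n i := by
  obtain ⟨k, hk⟩ := Cn.ne_zero_iff.mp hz
  have hki : k = i := by_contra fun hki => hk (h k hki)
  subst hki
  fin_cases k
  · have h1 : z 1 = 0 := h 1 (by decide)
    simp_all [_root_.leafOrder]
  · have h0 : z 0 = 0 := h 0 (by decide)
    simp [_root_.leafOrder, h0]

end Germs

/-! ### Matching the coordinate axes under an equivalence of germs -/

section AxisGerms

variable {n n' : Fin 2 → ℕ} {l l' : ℝ}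

/-- `φ` maps points of the `i`-th axis arbitrarily close to `0` into the `j`-th axis. -/
def MapsAxis (φ : OpenPartialHomeomorph (Cn 2) (Cn 2)) (i j : Fin 2) : Prop :=
  ∃ᶠ r : ℝ in 𝓝[>] (0 : ℝ), OnAxis j (φ (EuclideanSpace.single i (r : ℂ)))

theorem tendsto_single (i : Fin 2) :
    Tendsto (fun r : ℝ => (EuclideanSpace.single i (r : ℂ) : Cn 2)) (𝓝[>] 0) (𝓝 0) := by
  rw [tendsto_zero_iff_norm_tendsto_zero]
  have : Tendsto (fun r : ℝ => ‖(r : ℂ)‖) (𝓝 0) (𝓝 0) := by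
    simpa using (by fun_prop : Continuous fun r : ℝ => ‖(r : ℂ)‖).tendsto 0
  simpa using this.mono_left nhdsWithin_le_nhds

theorem single_ofReal_ne_zero (i : Fin 2) {r : ℝ} (hr : 0 < r) :
    (EuclideanSpace.single i (r : ℂ) : Cn 2) ≠ 0 :=
  Cn.ne_zero_iff.mpr ⟨i, by simp [hr.ne']⟩

theorem eventually_norm_eq_mem {U : Set (Cn 2)} (hU : IsOpen U) (h0 : (0 : Cn 2) ∈ U)
    (i : Fin 2) :
    ∀ᶠ r : ℝ in 𝓝[>] (0 : ℝ), 0 < r ∧ ∀ w : ℂ, ‖w‖ = r → (EuclideanSpace.single i w : Cn 2) ∈ U := by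
  obtain ⟨ε, hε, hsub⟩ := Metric.isOpen_iff.mp hU 0 h0
  filter_upwards [Ioo_mem_nhdsGT hε] with r hr
  refine ⟨hr.1, fun w hw => hsub ?_⟩
  rw [mem_ball_zero_iff, PiLp.norm_single, hw]
  exact hr.2

/-- If `φ` maps one small point of an axis into an axis, then the preimages of all small points of
the latter lie in the former. -/
theorem MapsAxis.eventually_symm {φ : OpenPartialHomeomorph (Cn 2) (Cn 2)} (hn : ∀ i, 0 < n i)
    (hl : 0 < l) (h : l = (n 0 : ℝ) / n 1) (hn' : ∀ i, 0 < n' i) (hl' : 0 < l')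
    (h' : l' = (n' 0 : ℝ) / n' 1)
    (hφ : LeafEquiv φ (linFoliation l hl) (linFoliation l' hl')) {i j : Fin 2}
    (hij : MapsAxis φ i j) :
    ∀ᶠ ρ : ℝ in 𝓝[>] (0 : ℝ), OnAxis i (φ.symm (EuclideanSpace.single j (ρ : ℂ))) := by
  obtain ⟨ε, hε, hsub⟩ := Metric.isOpen_iff.mp φ.open_target 0 hφ.symm.zero_mem
  have htend : Tendsto (fun r : ℝ => φ (EuclideanSpace.single i (r : ℂ))) (𝓝[>] 0) (𝓝 0) := by
    have := (φ.continuousAt hφ.zero_mem).tendsto.comp (tendsto_single i)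
    rwa [hφ.map_zero] at this
  obtain ⟨r, haxis, hball, hr, hmem⟩ := (hij.and_eventually
    ((htend.eventually (Metric.ball_mem_nhds 0 hε)).and
      (eventually_norm_eq_mem φ.open_source hφ.zero_mem i))).exists
  replace hball : φ (EuclideanSpace.single i (r : ℂ)) ∈ Metric.ball (0 : Cn 2) ε := hball
  have hxs : (EuclideanSpace.single i (r : ℂ) : Cn 2) ∈ φ.source :=
    hmem _ (by rw [Complex.norm_real, Real.norm_of_nonneg hr.le])
  have hx0 := single_ofReal_ne_zero i hr
  have hw0 := hφ.map_ne_zero hxs hx0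
  set x : Cn 2 := EuclideanSpace.single i (r : ℂ) with hx
  set a : ℂ := φ x j with ha
  have hwa : φ x = EuclideanSpace.single j a := haxis.eq_single
  rw [hwa, mem_ball_zero_iff, PiLp.norm_single] at hball
  have ha0 : a ≠ 0 := by
    rintro h0
    rw [h0] at hwa
    exact hw0 (by rw [hwa]; ext k; simp)
  filter_upwards [Ioo_mem_nhdsGT hε] with ρ hρ
  have hρ0 : (ρ : ℂ) ≠ 0 := by exact_mod_cast hρ.1.ne'
  -- The spiral `exp (t * L) * a` joins `a` to `ρ`. Its modulus is monotone between those of its end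
  -- points, so it stays in the ball, and both points lie in one leaf.
  set L := Complex.log (ρ / a) with hL
  have hexpL : Complex.exp L = ρ / a := Complex.exp_log (div_ne_zero hρ0 ha0)
  have hnj : ((n' j : ℕ) : ℂ) ≠ 0 := by exact_mod_cast (hn' j).ne'
  have hflow : ∀ t : ℝ, wflow n' (t * L / n' j) (φ x)
      = EuclideanSpace.single j (Complex.exp (t * L) * a) := by
    intro t
    rw [hwa, wflow_single]
    congr 3
    field_simp
  have hleaf : (EuclideanSpace.single j (ρ : ℂ) : Cn 2)
      ∈ (linFoliation l' hl').leaf φ.target (φ x) := by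
    refine (mem_leaf_iff hn' hl' h' φ.open_target hw0).mpr
      ⟨fun t => t * L / n' j, by fun_prop, by simp, ?_, fun t ht => hsub ?_⟩
    · simp only [hflow]
      rw [Complex.ofReal_one, one_mul, hexpL, div_mul_cancel₀ _ ha0]
    · simp only [hflow]
      rw [mem_ball_zero_iff, PiLp.norm_single, norm_mul, Complex.norm_exp,
        Complex.re_ofReal_mul]
      rcases le_total L.re 0 with hre | hre
      · refine lt_of_le_of_lt (mul_le_of_le_one_left (norm_nonneg _) ?_) hball
        exact Real.exp_le_one_iff.mpr (mul_nonpos_of_nonneg_of_nonpos ht.1 hre)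
      · refine lt_of_le_of_lt ?_ hρ.2
        have : Real.exp L.re * ‖a‖ = ρ := by
          rw [← Complex.norm_exp, hexpL, norm_div, Complex.norm_real,
            Real.norm_of_nonneg hρ.1.le, div_mul_cancel₀ _ (norm_ne_zero_iff.mpr ha0)]
        rw [← this]
        gcongr
        exact mul_le_of_le_one_left hre ht.2
  have hsource := hφ.symm.map_mem_leaf (φ.map_source hxs) (by simpa using hleaf)
  rw [φ.left_inv hxs, φ.symm_target] at hsource
  obtain ⟨s, hs⟩ := exists_time_of_mem_leaf hn hl h φ.open_source hsource
  intro k hk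
  rw [hs, hx, wflow_single]
  simp [hk]

theorem MapsAxis.symm {φ : OpenPartialHomeomorph (Cn 2) (Cn 2)} (hn : ∀ i, 0 < n i)
    (hl : 0 < l) (h : l = (n 0 : ℝ) / n 1) (hn' : ∀ i, 0 < n' i) (hl' : 0 < l')
    (h' : l' = (n' 0 : ℝ) / n' 1)
    (hφ : LeafEquiv φ (linFoliation l hl) (linFoliation l' hl')) {i j : Fin 2}
    (hij : MapsAxis φ i j) : MapsAxis φ.symm j i :=
  (hij.eventually_symm hn hl h hn' hl' h' hφ).frequently

theorem MapsAxis.unique {φ : OpenPartialHomeomorph (Cn 2) (Cn 2)} (hn : ∀ i, 0 < n i)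
    (hl : 0 < l) (h : l = (n 0 : ℝ) / n 1) (hn' : ∀ i, 0 < n' i) (hl' : 0 < l')
    (h' : l' = (n' 0 : ℝ) / n' 1)
    (hφ : LeafEquiv φ (linFoliation l hl) (linFoliation l' hl')) {i i' j : Fin 2}
    (hij : MapsAxis φ i j) (hij' : MapsAxis φ i' j) : i = i' := by
  obtain ⟨ρ, ⟨h1, h2⟩, hρ, hmem⟩ := (((hij.eventually_symm hn hl h hn' hl' h' hφ).and
    (hij'.eventually_symm hn hl h hn' hl' h' hφ)).and
      (eventually_norm_eq_mem φ.open_target hφ.symm.zero_mem j)).exists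
  refine h1.unique h2 (hφ.symm.map_ne_zero ?_ (single_ofReal_ne_zero j hρ))
  exact hmem _ (by rw [Complex.norm_real, Real.norm_of_nonneg hρ.le])

theorem MapsAxis.dvd {φ : OpenPartialHomeomorph (Cn 2) (Cn 2)} (hn : ∀ i, 0 < n i)
    (hc : (n 0).Coprime (n 1)) (hl : 0 < l) (h : l = (n 0 : ℝ) / n 1) (hn' : ∀ i, 0 < n' i)
    (hc' : (n' 0).Coprime (n' 1)) (hl' : 0 < l') (h' : l' = (n' 0 : ℝ) / n' 1)
    (hφ : LeafEquiv φ (linFoliation l hl) (linFoliation l' hl')) {i j : Fin 2}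
    (hij : MapsAxis φ i j) : n i ∣ n' j := by
  obtain ⟨r, haxis, hr, hmem⟩ := (hij.and_eventually
    (eventually_norm_eq_mem φ.open_source hφ.zero_mem i)).exists
  have h1 := leafOrder_map_dvd hn hc hl h hn' hc' hl' h' hφ hr hmem
  rwa [haxis.leafOrder (hφ.map_ne_zero (hmem _ (by rw [Complex.norm_real,
    Real.norm_of_nonneg hr.le])) (single_ofReal_ne_zero i hr))] at h1

/-- Off the axes the leaf order is `1`, which `n i > 1` does not divide, so small points of the axis
go to axes, and one of the two is hit frequently. Divisibility in both directions then gives equal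
weights. -/
theorem exists_mapsAxis {φ : OpenPartialHomeomorph (Cn 2) (Cn 2)} (hn : ∀ i, 0 < n i)
    (hc : (n 0).Coprime (n 1)) (hl : 0 < l) (h : l = (n 0 : ℝ) / n 1) (hn' : ∀ i, 0 < n' i)
    (hc' : (n' 0).Coprime (n' 1)) (hl' : 0 < l') (h' : l' = (n' 0 : ℝ) / n' 1)
    (hφ : LeafEquiv φ (linFoliation l hl) (linFoliation l' hl')) {i : Fin 2} (hi : 1 < n i) :
    ∃ j, MapsAxis φ i j ∧ n' j = n i := by
  have hev : ∀ᶠ r : ℝ in 𝓝[>] (0 : ℝ), OnAxis 0 (φ (EuclideanSpace.single i (r : ℂ))) ∨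
      OnAxis 1 (φ (EuclideanSpace.single i (r : ℂ))) := by
    filter_upwards [eventually_norm_eq_mem φ.open_source hφ.zero_mem i] with r hr
    have h1 := leafOrder_map_dvd hn hc hl h hn' hc' hl' h' hφ hr.1 hr.2
    unfold leafOrder at h1
    split_ifs at h1 with h2 h3
    · exact Or.inr (Fin.forall_fin_two.mpr ⟨fun _ => h2, fun h => absurd rfl h⟩)
    · exact Or.inl (Fin.forall_fin_two.mpr ⟨fun h => absurd rfl h, fun _ => h3⟩)
    · exact absurd (Nat.dvd_one.mp h1) hi.ne'
  have hex : ∃ j, MapsAxis φ i j := by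
    rcases frequently_or_distrib.mp hev.frequently with h1 | h1
    exacts [⟨0, h1⟩, ⟨1, h1⟩]
  obtain ⟨j, hj⟩ := hex
  exact ⟨j, hj, Nat.dvd_antisymm
    ((hj.symm hn hl h hn' hl' h' hφ).dvd hn' hc' hl' h' hn hc hl h hφ.symm)
    (hj.dvd hn hc hl h hn' hc' hl' h' hφ)⟩

/-- The weights are topological invariants up to order. -/
theorem LeafEquiv.weights_eq {φ : OpenPartialHomeomorph (Cn 2) (Cn 2)} (hn : ∀ i, 0 < n i)
    (hc : (n 0).Coprime (n 1)) (hl : 0 < l) (h : l = (n 0 : ℝ) / n 1) (hn' : ∀ i, 0 < n' i)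
    (hc' : (n' 0).Coprime (n' 1)) (hl' : 0 < l') (h' : l' = (n' 0 : ℝ) / n' 1)
    (hφ : LeafEquiv φ (linFoliation l hl) (linFoliation l' hl')) :
    (n 0 = n' 0 ∧ n 1 = n' 1) ∨ (n 0 = n' 1 ∧ n 1 = n' 0) := by
  have A : ∀ i, 1 < n i → ∃ j, MapsAxis φ i j ∧ n' j = n i := fun i hi =>
    exists_mapsAxis hn hc hl h hn' hc' hl' h' hφ hi
  have B : ∀ j, 1 < n' j → ∃ i, MapsAxis φ i j ∧ n i = n' j := fun j hj => by
    obtain ⟨i, hi, e⟩ := exists_mapsAxis hn' hc' hl' h' hn hc hl h hφ.symm hj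
    exact ⟨i, by simpa using hi.symm hn' hl' h' hn hl h hφ.symm, e⟩
  have U : ∀ j, ¬ (MapsAxis φ 0 j ∧ MapsAxis φ 1 j) := fun j hj =>
    absurd (hj.1.unique hn hl h hn' hl' h' hφ hj.2) (by decide)
  have U' : ∀ i, ¬ (MapsAxis φ i 0 ∧ MapsAxis φ i 1) := fun i hi => by
    have h0 := hi.1.symm hn hl h hn' hl' h' hφ
    have h1 := hi.2.symm hn hl h hn' hl' h' hφ
    exact absurd (h0.unique hn' hl' h' hn hl h hφ.symm h1) (by decide)
  simp only [Fin.forall_fin_two, Fin.exists_fin_two, not_and] at A B U U' hn hn'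
  -- `A` and `B` match the weights greater than `1` on either side with equal ones, `U` and `U'`
  -- make the matching injective, and every unmatched weight is `1`.
  grind

end AxisGerms

/-! ### Rational exponents and the classification of the germs -/

section Classification

variable {l m : ℚ}

/-- The weights of a positive rational number. -/
def ratWeights (l : ℚ) : Fin 2 → ℕ := ![l.num.toNat, l.den]

theorem ratWeights_pos (hl : 0 < l) (i : Fin 2) : 0 < ratWeights l i := by
  have := Rat.num_pos.mpr hl
  fin_cases i
  · simp [ratWeights]; omega
  · simp [ratWeights, l.den_pos]

theorem ratWeights_coprime (hl : 0 < l) : (ratWeights l 0).Coprime (ratWeights l 1) := by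
  have h := l.reduced
  have := Rat.num_pos.mpr hl
  rwa [← Int.toNat_of_nonneg this.le, Int.natAbs_natCast] at h

theorem eq_ratWeights_div (hl : 0 < l) : l = (ratWeights l 0 : ℚ) / ratWeights l 1 := by
  have h1 : ((l.num.toNat : ℕ) : ℚ) = l.num := by
    exact_mod_cast Int.toNat_of_nonneg (Rat.num_pos.mpr hl).le
  simp only [ratWeights, Matrix.cons_val_zero, Matrix.cons_val_one, h1]
  exact l.num_div_den.symm

theorem coe_eq_ratWeights_div (hl : 0 < l) :
    (l : ℝ) = (ratWeights l 0 : ℝ) / ratWeights l 1 := by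
  conv_lhs => rw [eq_ratWeights_div hl]
  push_cast; rfl

/-- The exchange of the two coordinates. -/
noncomputable def swapCoord : Cn 2 ≃ₜ Cn 2 :=
  (LinearIsometryEquiv.piLpCongrLeft 2 ℂ ℂ (Equiv.swap (0 : Fin 2) 1)).toHomeomorph

theorem swapCoord_apply (z : Cn 2) (i : Fin 2) : swapCoord z i = z (Equiv.swap 0 1 i) := by
  simp [swapCoord, LinearIsometryEquiv.piLpCongrLeft_apply, Equiv.piCongrLeft']

theorem swapCoord_wflow {n n' : Fin 2 → ℕ} (h : ∀ i, n' i = n (Equiv.swap 0 1 i)) (s : ℂ)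
    (z : Cn 2) : swapCoord (wflow n s z) = wflow n' s (swapCoord z) := by
  ext i
  simp only [swapCoord_apply, wflow_apply, h]

theorem linFoliation_topEquiv_iff (hl : 0 < l) (hm : 0 < m) :
    (linFoliation l (Rat.cast_pos.mpr hl)).TopEquiv (linFoliation m (Rat.cast_pos.mpr hm)) ↔
      l = m ∨ l = 1 / m := by
  have hn := ratWeights_pos hl
  have hn' := ratWeights_pos hm
  have hl' := eq_ratWeights_div hl
  have hm' := eq_ratWeights_div hm
  constructor
  · rintro ⟨φ, -, -, h0, hφ0, hφ⟩
    have := LeafEquiv.weights_eq hn (ratWeights_coprime hl) _ (coe_eq_ratWeights_div hl) hn'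
      (ratWeights_coprime hm) _ (coe_eq_ratWeights_div hm) ⟨h0, hφ0, hφ⟩
    rcases this with ⟨e0, e1⟩ | ⟨e0, e1⟩
    · left; rw [hl', hm', e0, e1]
    · right; rw [hl', hm', e0, e1, one_div_div]
  · rintro (rfl | rfl)
    · exact ⟨OpenPartialHomeomorph.refl _, subset_univ _, subset_univ _, mem_univ _, rfl,
        fun p _ _ => by simp⟩
    -- The exchanged weights of `m` are weights for `1 / m`, and the exchange of coordinates
    -- conjugates the two flows.
    · set n : Fin 2 → ℕ := fun i => ratWeights m (Equiv.swap 0 1 i) with hndef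
      have hnpos : ∀ i, 0 < n i := fun i => hn' _
      have hln : (((1 / m : ℚ) : ℝ)) = (n 0 : ℝ) / n 1 := by
        simp only [hndef, Equiv.swap_apply_left, Equiv.swap_apply_right]
        push_cast
        rw [coe_eq_ratWeights_div hm, one_div_div]
      refine ⟨swapCoord.toOpenPartialHomeomorph, subset_univ _, subset_univ _, mem_univ _, ?_,
        fun p _ hp => ?_⟩
      · ext i; simp [swapCoord_apply]
      · have hflow := fun s z => swapCoord_wflow (n := n) (n' := ratWeights m)
          (fun i => by simp [hndef]) s z
        have hp' : swapCoord p ≠ 0 := by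
          obtain ⟨i, hi⟩ := Cn.ne_zero_iff.mp hp
          exact Cn.ne_zero_iff.mpr ⟨Equiv.swap 0 1 i, by simpa [swapCoord_apply] using hi⟩
        ext w
        simp only [Homeomorph.toOpenPartialHomeomorph_apply,
          Homeomorph.toOpenPartialHomeomorph_source, Homeomorph.toOpenPartialHomeomorph_target]
        rw [mem_leaf_iff hn' _ (coe_eq_ratWeights_div hm) isOpen_univ hp']
        constructor
        · rintro ⟨u, hu, rfl⟩
          obtain ⟨S, hS, hS0, hS1, -⟩ := (mem_leaf_iff hnpos _ hln isOpen_univ hp).mp hu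
          exact ⟨S, hS, hS0, by rw [← hflow, hS1], fun _ _ => mem_univ _⟩
        · rintro ⟨S, hS, hS0, hS1, -⟩
          exact ⟨wflow n (S 1) p, (mem_leaf_iff hnpos _ hln isOpen_univ hp).mpr
            ⟨S, hS, hS0, rfl, fun _ _ => mem_univ _⟩, (hflow _ _).trans hS1⟩

end Classification

/-! ### Invariance of the holonomy order under homeomorphisms -/

section Transport

variable {X Y : Type*} [TopologicalSpace X] [TopologicalSpace Y]

theorem HolFoliation.IsSimpleLoop.map {γ : ℝ → X} {L : Set X} (h : IsSimpleLoop γ L) (φ : X ≃ₜ Y) :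
    IsSimpleLoop (fun t => φ (γ t)) (φ '' L) where
  continuousOn := φ.continuous.comp_continuousOn h.continuousOn
  closed := by simp only [h.closed]
  injOn := φ.injective.comp_injOn h.injOn
  image_eq := by rw [← h.image_eq, image_image]

theorem HolFoliation.IsTransversal.map {leaf : X → Set X} {leaf' : Y → Set Y} {D : Set X} {x : X}
    (h : IsTransversal leaf D x) (φ : X ≃ₜ Y) (hφ : ∀ z, φ '' leaf z = leaf' (φ z)) :
    IsTransversal leaf' (φ '' D) (φ x) := by
  obtain ⟨hx, e, he, hz⟩ := h
  refine ⟨mem_image_of_mem _ hx,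
    fun p => φ (e (((φ.image D).symm.prodCongr (Homeomorph.refl ℝ)) p)),
    φ.isOpenEmbedding.comp (he.comp (Homeomorph.isOpenEmbedding _)), fun z => ?_⟩
  obtain ⟨w, rfl⟩ := (φ.image D).surjective z
  have hw : (((φ.image D) w : φ '' D) : Y) = φ w := rfl
  simp only [Homeomorph.coe_prodCongr, Prod.map_apply, Homeomorph.symm_apply_apply,
    Homeomorph.refl_apply, hw, id_eq, (hz w).1, true_and]
  intro s
  rw [← hφ]
  exact mem_image_of_mem _ ((hz w).2 s)

theorem HolFoliation.IsHolonomy.map {leaf : X → Set X} {leaf' : Y → Set Y} {D : Set X} {γ : ℝ → X} {h : X → X}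
    (hh : IsHolonomy leaf D γ h) (φ : X ≃ₜ Y) (hφ : ∀ z, φ '' leaf z = leaf' (φ z)) :
    IsHolonomy leaf' (φ '' D) (fun t => φ (γ t)) (fun y => φ (h (φ.symm y))) := by
  obtain ⟨N, hND, hN, H, hH, hHγ, hH2⟩ := hh
  refine ⟨φ '' N, image_mono hND, ?_, fun p => φ (H (φ.symm p.1, p.2)), ?_, ?_, ?_⟩
  · rw [← φ.isEmbedding.map_nhdsWithin_eq]
    exact image_mem_map hN
  · refine φ.continuous.comp_continuousOn (hH.comp (by fun_prop) ?_)
    rintro ⟨_, s⟩ ⟨⟨z, hz, rfl⟩, hs⟩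
    exact ⟨by simpa using hz, hs⟩
  · intro s hs
    simp [hHγ s hs]
  · rintro _ ⟨z, hz, rfl⟩
    obtain ⟨h0, h1, h2, h3⟩ := hH2 z hz
    simp only [φ.symm_apply_apply, h0, h1, true_and]
    exact ⟨mem_image_of_mem _ h2, fun s hs => hφ z ▸ mem_image_of_mem _ (h3 s hs)⟩

theorem HolFoliation.HasGermOrder.map {D : Set X} {x : X} {h : X → X} {k : ℕ} (hk : HasGermOrder D x h k)
    (φ : X ≃ₜ Y) : HasGermOrder (φ '' D) (φ x) (fun y => φ (h (φ.symm y))) k := by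
  have hiter : ∀ j z, (fun y => φ (h (φ.symm y)))^[j] (φ z) = φ (h^[j] z) := fun j z =>
    (Function.Semiconj.iterate_right (f := φ) (ga := h) (fun z => by simp) j z).symm
  have key : ∀ j, (fun y => φ (h (φ.symm y)))^[j] =ᶠ[𝓝[φ '' D] (φ x)] id ↔
      h^[j] =ᶠ[𝓝[D] x] id := by
    intro j
    rw [← φ.isEmbedding.map_nhdsWithin_eq, EventuallyEq, EventuallyEq, eventually_map]
    simp only [hiter, id_eq, φ.injective.eq_iff]
  unfold HasGermOrder at hk ⊢
  simpa only [key] using hk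

theorem HolFoliation.HasHolonomyOrder.map {leaf : X → Set X} {leaf' : Y → Set Y} {L : Set X} {k : ℕ}
    (h : HasHolonomyOrder leaf L k) (φ : X ≃ₜ Y) (hφ : ∀ z, φ '' leaf z = leaf' (φ z)) :
    HasHolonomyOrder leaf' (φ '' L) k := by
  obtain ⟨γ, D, g, h1, h2, h3, h4, h5⟩ := h
  refine ⟨_, _, _, h1.map φ, ?_, h3.map φ hφ, h4.map φ hφ, h5.map φ⟩
  rintro _ ⟨z, hz, rfl⟩
  rw [← hφ, h2 z hz]

theorem hasHolonomyOrder_image_iff {leaf : X → Set X} {leaf' : Y → Set Y} {L : Set X} {k : ℕ}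
    (φ : X ≃ₜ Y) (hφ : ∀ z, φ '' leaf z = leaf' (φ z)) :
    HasHolonomyOrder leaf L k ↔ HasHolonomyOrder leaf' (φ '' L) k := by
  refine ⟨fun h => h.map φ hφ, fun h => ?_⟩
  have h1 := h.map φ.symm (leaf' := leaf) (fun z => by
    obtain ⟨w, rfl⟩ := φ.surjective z
    rw [← hφ, φ.symm_apply_apply, image_image]
    simp)
  rw [image_image] at h1
  simpa using h1

end Transport

/-! ### The leaves of the trace foliation -/

/-- The orbit of a point under the flow on the sphere. -/
def sphereOrbit (n : Fin 2 → ℕ) (z : Sph 2) : Set (Sph 2) := range fun t => sflow n t z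

/-- The circle in which the `i`-th axis meets the sphere. -/
def axisCircle (i : Fin 2) : Set (Sph 2) := {z | OnAxis i (z : Cn 2)}

/-- The index of a circle is that of its nonvanishing coordinate; hence `{x = 0}` belongs to the
weight `n 1`, the denominator. -/
theorem circleX_eq : circleX = axisCircle 1 := by
  ext z
  simp [circleX, axisCircle, OnAxis, Fin.forall_fin_two]

theorem circleY_eq : circleY = axisCircle 0 := by
  ext z
  simp [circleY, axisCircle, OnAxis, Fin.forall_fin_two]

section SphereFlow

variable {n : Fin 2 → ℕ}

theorem sflow_int_period (k : ℤ) (z : Sph 2) : sflow n (k * (2 * Real.pi)) z = z := by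
  ext1
  rw [coe_sflow]
  convert! wflow_int_period (n := n) k (z : Cn 2) using 2
  push_cast; ring

theorem norm_apply_of_mem_axisCircle {i : Fin 2} {z : Sph 2} (hz : z ∈ axisCircle i) :
    ‖(z : Cn 2) i‖ = 1 := by
  have h1 := mem_sphere_zero_iff_norm.mp z.2
  rwa [OnAxis.eq_single hz, PiLp.norm_single] at h1

theorem sflow_mem_axisCircle {i : Fin 2} {z : Sph 2} (hz : z ∈ axisCircle i) (t : ℝ) :
    sflow n t z ∈ axisCircle i := fun j hj => wflow_apply_eq_zero.mpr (hz j hj)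

theorem exp_eq_one_of_sflow_eq_self {t : ℝ} {z : Sph 2} (h : sflow n t z = z) {i : Fin 2}
    (hi : (z : Cn 2) i ≠ 0) : ∃ k : ℤ, n i * t = k * (2 * Real.pi) := by
  have h1 : wflow n (t * Complex.I) (z : Cn 2) = z := congrArg Subtype.val h
  obtain ⟨k, hk⟩ := Complex.exp_eq_one_iff.mp (exp_eq_one_of_wflow_eq_self h1 hi)
  refine ⟨k, ?_⟩
  have h2 : ((n i * t : ℝ) : ℂ) * Complex.I = ((k * (2 * Real.pi) : ℝ) : ℂ) * Complex.I := by
    push_cast; linear_combination hk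
  exact_mod_cast mul_right_cancel₀ Complex.I_ne_zero h2

theorem sflow_axis_period (hn : ∀ i, 0 < n i) {i : Fin 2} {z : Sph 2} (hz : z ∈ axisCircle i)
    (k : ℤ) : sflow n (k * (2 * Real.pi / n i)) z = z := by
  have hni : ((n i : ℕ) : ℂ) ≠ 0 := by exact_mod_cast (hn i).ne'
  ext1
  rw [coe_sflow, OnAxis.eq_single hz, wflow_single]
  have : Complex.exp (n i * (((k * (2 * Real.pi / n i) : ℝ) : ℂ) * Complex.I)) = 1 :=
    Complex.exp_eq_one_iff.mpr ⟨k, by push_cast; field_simp⟩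
  rw [this, one_mul]

theorem sphereOrbit_axisCircle (hn : ∀ i, 0 < n i) {i : Fin 2} {z : Sph 2}
    (hz : z ∈ axisCircle i) : sphereOrbit n z = axisCircle i := by
  refine Subset.antisymm ?_ fun w hw => ?_
  · rintro _ ⟨t, rfl⟩
    exact sflow_mem_axisCircle hz t
  · have hz1 := norm_apply_of_mem_axisCircle hz
    have hw1 := norm_apply_of_mem_axisCircle hw
    have hni : ((n i : ℕ) : ℂ) ≠ 0 := by exact_mod_cast (hn i).ne'
    have hz0 : (z : Cn 2) i ≠ 0 := norm_ne_zero_iff.mp (by rw [hz1]; exact one_ne_zero)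
    -- The quotient of the two unimodular coordinates is a rotation, and the flow turns this
    -- coordinate with speed `n i`.
    refine ⟨Complex.arg ((w : Cn 2) i / (z : Cn 2) i) / n i, Subtype.ext ?_⟩
    have he : (n i * (((Complex.arg ((w : Cn 2) i / (z : Cn 2) i) / n i : ℝ) : ℂ) * Complex.I) : ℂ)
        = Complex.arg ((w : Cn 2) i / (z : Cn 2) i) * Complex.I := by push_cast; field_simp
    have h1 := Complex.norm_mul_exp_arg_mul_I ((w : Cn 2) i / (z : Cn 2) i)
    rw [norm_div, hz1, hw1, div_one, Complex.ofReal_one, one_mul] at h1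
    rw [coe_sflow, OnAxis.eq_single hz, wflow_single, ← OnAxis.eq_single hz, he, h1,
      div_mul_cancel₀ _ hz0]
    exact (OnAxis.eq_single hw).symm

theorem isClosed_sphereOrbit (z : Sph 2) : IsClosed (sphereOrbit n z) := by
  have hp : Function.Periodic (fun t => sflow n t z) (2 * Real.pi) := fun t => by
    have := sflow_int_period (n := n) 1 z
    rw [Int.cast_one, one_mul] at this
    simp only [sflow_add, this]
  exact (hp.compact_of_continuous Real.two_pi_pos.ne' (by fun_prop)).isClosed

theorem isSimpleLoop_sflow {z : Sph 2} {c : ℝ} (hc : 0 < c) (hper : sflow n c z = z)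
    (hmin : ∀ t, sflow n t z = z → ∃ k : ℤ, t = k * c) :
    IsSimpleLoop (fun t => sflow n (c * t) z) (sphereOrbit n z) where
  continuousOn := Continuous.continuousOn (by fun_prop)
  closed := by simp [hper]
  injOn := by
    intro s hs t ht hst
    obtain ⟨k, hk⟩ := hmin (c * (s - t)) (by
      rw [mul_sub, sub_eq_neg_add, sflow_add]
      simp only at hst
      rw [hst, ← sflow_add]; simp)
    have h1 : s - t = k := mul_left_cancel₀ hc.ne' (by rw [hk, mul_comm])
    have h2 : -(1 : ℝ) < k := by rw [← h1]; linarith [hs.1, ht.2]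
    have h3 : (k : ℝ) < 1 := by rw [← h1]; linarith [hs.2, ht.1]
    have h4 : k = 0 := by
      have : -1 < k := by exact_mod_cast h2
      have : k < 1 := by exact_mod_cast h3
      omega
    rw [h4, Int.cast_zero] at h1
    linarith
  image_eq := by
    have hp : Function.Periodic (fun t => sflow n (c * t) z) 1 := fun t => by
      simp only [mul_add, mul_one, sflow_add, hper]
    have h1 := hp.image_Icc one_pos 0
    rw [zero_add] at h1
    rw [h1]
    ext w
    constructor
    · rintro ⟨t, rfl⟩; exact ⟨c * t, rfl⟩
    · rintro ⟨t, rfl⟩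
      exact ⟨t / c, by simp only [mul_div_cancel₀ _ hc.ne']⟩

theorem isSimpleLoop_axisCircle (hn : ∀ i, 0 < n i) {i : Fin 2} {z : Sph 2}
    (hz : z ∈ axisCircle i) :
    IsSimpleLoop (fun t => sflow n (2 * Real.pi / n i * t) z) (axisCircle i) := by
  have hni : (0 : ℝ) < n i := by exact_mod_cast hn i
  rw [← sphereOrbit_axisCircle hn hz]
  refine isSimpleLoop_sflow (div_pos Real.two_pi_pos hni) ?_ fun t ht => ?_
  · simpa using sflow_axis_period hn hz 1
  · obtain ⟨k, hk⟩ := exp_eq_one_of_sflow_eq_self ht (i := i)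
      (norm_ne_zero_iff.mp (by rw [norm_apply_of_mem_axisCircle hz]; exact one_ne_zero))
    exact ⟨k, by field_simp; linarith⟩

theorem exists_int_of_sflow_eq_self (hc : (n 0).Coprime (n 1)) {t : ℝ} {z : Sph 2}
    (h : sflow n t z = z) (hz : ∀ i, (z : Cn 2) i ≠ 0) : ∃ k : ℤ, t = k * (2 * Real.pi) := by
  obtain ⟨k, hk⟩ := exists_int_of_wflow_eq_self hc (congrArg Subtype.val h) hz
  refine ⟨k, ?_⟩
  have h2 : (t : ℂ) * Complex.I = ((k * (2 * Real.pi) : ℝ) : ℂ) * Complex.I := by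
    push_cast; linear_combination hk
  exact_mod_cast mul_right_cancel₀ Complex.I_ne_zero h2

theorem hasWindingNumber_sflow {z : Sph 2} {i : Fin 2} (hi : (z : Cn 2) i ≠ 0) :
    HasWindingNumber (fun t => (sflow n (2 * Real.pi * t) z : Cn 2) i) (n i) := by
  refine ⟨fun t => n i * (2 * Real.pi * t) + Complex.arg ((z : Cn 2) i),
    Continuous.continuousOn (by fun_prop), fun t _ => ⟨?_, ?_⟩, ?_⟩
  · exact fun h => hi (wflow_apply_eq_zero.mp h)
  · have e : (n i * (((2 * Real.pi * t : ℝ) : ℂ) * Complex.I) : ℂ)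
        = ((n i * (2 * Real.pi * t) : ℝ) : ℂ) * Complex.I := by push_cast; ring
    simp only [coe_sflow, wflow_apply, e, norm_mul, Complex.norm_exp_ofReal_mul_I, one_mul]
    rw [Complex.ofReal_add, add_mul, Complex.exp_add,
      mul_left_comm (‖(z : Cn 2) i‖ : ℂ), Complex.norm_mul_exp_arg_mul_I]
  · push_cast; ring

theorem isTorusKnot_sphereOrbit (hc : (n 0).Coprime (n 1)) {z : Sph 2}
    (hz : ∀ i, (z : Cn 2) i ≠ 0) :
    IsTorusKnot ‖(z : Cn 2) 0‖ (n 0) (n 1) (sphereOrbit n z) := by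
  refine ⟨norm_pos_iff.mpr (hz 0), ?_, ?_, fun t => sflow n (2 * Real.pi * t) z,
    isSimpleLoop_sflow Real.two_pi_pos ?_ fun t ht => exists_int_of_sflow_eq_self hc ht hz,
    hasWindingNumber_sflow (hz 0), hasWindingNumber_sflow (hz 1)⟩
  · have h1 := mem_sphere_zero_iff_norm.mp z.2
    have h2 := EuclideanSpace.norm_sq_eq (z : Cn 2)
    rw [h1, Fin.sum_univ_two] at h2
    have h3 := norm_pos_iff.mpr (hz 1)
    nlinarith [norm_nonneg ((z : Cn 2) 0)]
  · rintro _ ⟨t, rfl⟩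
    have e : (n 0 * ((t : ℂ) * Complex.I) : ℂ) = ((n 0 * t : ℝ) : ℂ) * Complex.I := by
      push_cast; ring
    simp only [coe_sflow, wflow_apply, e, norm_mul, Complex.norm_exp_ofReal_mul_I, one_mul]
  · simpa using sflow_int_period (n := n) 1 z

end SphereFlow

/-! ### Holonomy of the trace foliation -/

section SphereHolonomy

variable {n : Fin 2 → ℕ}

theorem exists_continuous_angle (hn : ∀ i, 0 < n i) {γ : ℝ → Sph 2} (hγ : Continuous γ)
    {z : Sph 2} (horb : ∀ t, γ t ∈ sphereOrbit n z) {t₀ : ℝ} (h0 : γ 0 = sflow n t₀ z) :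
    ∃ T : ℝ → ℝ, Continuous T ∧ T 0 = t₀ ∧ ∀ t, γ t = sflow n (T t) z := by
  have hz := sphere_point_ne_zero z
  obtain ⟨S, hS, hS0, hSt⟩ := exists_continuous_time hn (γ := fun t => (γ t : Cn 2))
    (by fun_prop) hz (fun t => by
      obtain ⟨u, hu⟩ := horb t
      exact ⟨u * Complex.I, by rw [← hu]; rfl⟩) (s₀ := t₀ * Complex.I) (by rw [h0]; rfl)
  have hre : ∀ t, (S t).re = 0 := fun t => re_eq_zero_of_norm_wflow_eq hn hz (by
    rw [← hSt t, mem_sphere_zero_iff_norm.mp (γ t).2, mem_sphere_zero_iff_norm.mp z.2])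
  refine ⟨fun t => (S t).im, by fun_prop, by simp [hS0], fun t => Subtype.ext ?_⟩
  rw [coe_sflow, hSt t]
  congr 1
  apply Complex.ext <;> simp [hre t]

theorem exists_continuous_angle_Icc (hn : ∀ i, 0 < n i) {γ : ℝ → Sph 2}
    (hγ : ContinuousOn γ (Icc 0 1)) {z : Sph 2}
    (horb : ∀ t ∈ Icc (0 : ℝ) 1, γ t ∈ sphereOrbit n z) (h0 : γ 0 = z) :
    ∃ T : ℝ → ℝ, Continuous T ∧ T 0 = 0 ∧ ∀ t ∈ Icc (0 : ℝ) 1, γ t = sflow n (T t) z := by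
  obtain ⟨T, hT, hT0, hTt⟩ := exists_continuous_angle hn (continuous_comp_projIcc hγ)
    (fun t => horb _ (Subtype.prop _)) (t₀ := 0) (by simp [h0])
  refine ⟨T, hT, hT0, fun t ht => ?_⟩
  rw [← hTt t, projIcc_of_mem zero_le_one ht]

/-- A continuous function that is injective on `[0, 1)` has different values at `0` and `1`. -/
theorem ne_of_injOn_Ico {f : ℝ → ℝ} (hf : Continuous f) (hinj : InjOn f (Ico 0 1)) :
    f 1 ≠ f 0 := by
  intro h10
  -- If `f 1 = f 0`, this value is attained on both halves of the interval; injectivity forces both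
  -- places to be `1 / 2`, where `f` has another value.
  set v := (f 0 + f (1 / 2)) / 2 with hv
  have hne : f (1 / 2) ≠ f 0 := fun h => by
    have := hinj ⟨by norm_num, by norm_num⟩ ⟨le_rfl, one_pos⟩ h
    norm_num at this
  have hmid : v ∈ uIcc (f 0) (f (1 / 2)) := by
    rw [mem_uIcc]
    rcases le_total (f 0) (f (1 / 2)) with h | h
    · left; constructor <;> linarith
    · right; constructor <;> linarith
  obtain ⟨s, hs, hsv⟩ := intermediate_value_uIcc (a := (0 : ℝ)) (b := 1 / 2) hf.continuousOn hmid
  obtain ⟨t, ht, htv⟩ := intermediate_value_uIcc (a := (1 : ℝ)) (b := 1 / 2) hf.continuousOn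
    (by rwa [h10])
  rw [uIcc_of_le (by norm_num)] at hs
  rw [uIcc_of_ge (by norm_num)] at ht
  have ht1 : t ≠ 1 := fun h => hne (by rw [h, h10] at htv; linarith)
  have hst : s = t := hinj ⟨hs.1, by linarith [hs.2]⟩
    ⟨by linarith [ht.1], lt_of_le_of_ne ht.2 ht1⟩ (hsv.trans htv.symm)
  have hs2 : s = 1 / 2 := le_antisymm hs.2 (hst ▸ ht.1)
  rw [hs2] at hsv
  exact hne (by linarith)

/-- A simple loop in an exceptional leaf runs around it once. -/
theorem exists_angle_of_isSimpleLoop (hn : ∀ i, 0 < n i) {i : Fin 2} {γ : ℝ → Sph 2}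
    (hγ : IsSimpleLoop γ (axisCircle i)) :
    ∃ T : ℝ → ℝ, Continuous T ∧ T 0 = 0 ∧ (∀ t ∈ Icc (0 : ℝ) 1, γ t = sflow n (T t) (γ 0)) ∧
      ∃ m : ℤ, |m| = 1 ∧ T 1 = m * (2 * Real.pi / n i) := by
  have hmem : ∀ t ∈ Icc (0 : ℝ) 1, γ t ∈ axisCircle i := fun t ht =>
    hγ.image_eq ▸ mem_image_of_mem _ ht
  have h0 := hmem 0 (by simp)
  have hni : (0 : ℝ) < n i := by exact_mod_cast hn i
  set w := 2 * Real.pi / n i with hw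
  have hw0 : 0 < w := div_pos Real.two_pi_pos hni
  obtain ⟨T, hT, hT0, hTt⟩ := exists_continuous_angle_Icc hn hγ.continuousOn
    (fun t ht => by rw [sphereOrbit_axisCircle hn h0]; exact hmem t ht) rfl
  have hinj : InjOn T (Ico 0 1) := fun s hs t ht hst => hγ.injOn hs ht (by
    rw [hTt s (Ico_subset_Icc_self hs), hTt t (Ico_subset_Icc_self ht), hst])
  obtain ⟨m, hm⟩ := exp_eq_one_of_sflow_eq_self
    (by rw [← hTt 1 (by simp), hγ.closed] : sflow n (T 1) (γ 0) = γ 0) (i := i)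
    (norm_ne_zero_iff.mp (by rw [norm_apply_of_mem_axisCircle h0]; exact one_ne_zero))
  have hm' : T 1 = m * w := by rw [hw]; field_simp; linarith
  refine ⟨T, hT, hT0, hTt, m, ?_, hm'⟩
  have hm0 : m ≠ 0 := fun h => ne_of_injOn_Ico hT hinj (by rw [hm', h, hT0]; simp)
  -- At such an intermediate multiple of the period the loop would return to its starting point too
  -- early. For `|m| > 1` this would occur at `w` or `-w`.
  have hno : ∀ k : ℤ, k ≠ 0 → k ≠ m → (k : ℝ) * w ∉ uIcc (T 0) (T 1) := by
    intro k hk hkm hmem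
    obtain ⟨t, ht, htk⟩ := intermediate_value_uIcc (a := (0 : ℝ)) (b := 1) hT.continuousOn hmem
    rw [uIcc_of_le zero_le_one] at ht
    have ht1 : t ≠ 1 := by
      rintro rfl
      rw [hm'] at htk
      exact hkm (by exact_mod_cast (mul_right_cancel₀ hw0.ne' htk).symm)
    have ht0 : t = 0 := hγ.injOn ⟨ht.1, lt_of_le_of_ne ht.2 ht1⟩ ⟨le_rfl, one_pos⟩ (by
      rw [hTt t ht, htk, sflow_axis_period hn h0])
    rw [ht0, hT0, eq_comm, mul_eq_zero] at htk
    rcases htk with h | h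
    · exact hk (by exact_mod_cast h)
    · exact hw0.ne' h
  rcases lt_trichotomy m 0 with h | h | h
  · by_contra hne
    rw [abs_of_neg h] at hne
    refine hno (-1) (by decide) (by omega) (mem_uIcc.mpr (Or.inr ⟨?_, ?_⟩))
    · rw [hm']
      exact mul_le_mul_of_nonneg_right (by exact_mod_cast (by omega : m ≤ -1)) hw0.le
    · rw [hT0]; push_cast; linarith
  · exact absurd h hm0
  · by_contra hne
    rw [abs_of_pos h] at hne
    refine hno 1 (by decide) (by omega) (mem_uIcc.mpr (Or.inl ⟨?_, ?_⟩))
    · rw [hT0]; push_cast; linarith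
    · rw [hm']
      exact mul_le_mul_of_nonneg_right (by exact_mod_cast (by omega : 1 ≤ m)) hw0.le

/-- A holonomy map along an exceptional leaf is the flow for a time close to that of the leaf. -/
theorem holonomy_eq_sflow (hn : ∀ i, 0 < n i) {i : Fin 2} {γ : ℝ → Sph 2}
    (hγ0 : γ 0 ∈ axisCircle i) {T : ℝ → ℝ} (hT : Continuous T) (hT0 : T 0 = 0)
    (hTt : ∀ t ∈ Icc (0 : ℝ) 1, γ t = sflow n (T t) (γ 0)) {D : Set (Sph 2)} {h : Sph 2 → Sph 2}
    (hD : γ 0 ∈ D) (hh : IsHolonomy (sphereOrbit n) D γ h) {ε : ℝ} (hε : 0 < ε) :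
    ∀ᶠ z in 𝓝[D] (γ 0), ∃ τ, |τ - T 1| < ε ∧ h z = sflow n τ z := by
  obtain ⟨N, hND, hN, H, hH, hHγ, hH2⟩ := hh
  have hni : (0 : ℝ) < n i := by exact_mod_cast hn i
  have hx1 := norm_apply_of_mem_axisCircle hγ0
  have hxN : γ 0 ∈ N := mem_of_mem_nhdsWithin hD hN
  -- The phase difference in the `i`-th coordinate is `n i` times the difference of the times,
  -- whence the bound `n i * ε`.
  have hlog : ∀ᶠ w in 𝓝 (1 : ℂ), w ∈ Complex.slitPlane ∧ ‖Complex.log w‖ < n i * ε := by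
    have h1 : Tendsto (fun w => ‖Complex.log w‖) (𝓝 1) (𝓝 0) := by
      simpa using (continuousAt_clog Complex.one_mem_slitPlane).norm.tendsto
    exact (Complex.isOpen_slitPlane.eventually_mem Complex.one_mem_slitPlane).and
      (h1.eventually_lt_const (mul_pos hni hε))
  obtain ⟨δ, hδ, hlogδ⟩ := Metric.eventually_nhds_iff.mp hlog
  obtain ⟨v, hv, hvu⟩ := isCompact_Icc.mem_uniformity_of_prod
    (f := fun z s => (H (z, s) : Cn 2) i) (s := N) (k := Icc (0 : ℝ) 1) (q := γ 0)
    (u := {p | dist p.1 p.2 < δ / 2})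
    ((by fun_prop : Continuous fun w : Sph 2 => (w : Cn 2) i).comp_continuousOn hH) hxN
    (Metric.dist_mem_uniformity (half_pos hδ))
  filter_upwards [nhdsWithin_le_of_mem hN hv, hN] with z hzv hzN
  obtain ⟨h0, h1, -, hleaf⟩ := hH2 z hzN
  obtain ⟨R, hR, hR0, hRt⟩ := exists_continuous_angle_Icc hn (γ := fun s => H (z, s))
    (hH.comp (by fun_prop) fun s hs => ⟨hzN, hs⟩) hleaf h0
  refine ⟨R 1, ?_, by rw [← h1, hRt 1 (by simp)]⟩
  set f : ℝ → ℂ := fun s => n i * ((R s - T s : ℝ) : ℂ) * Complex.I with hf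
  have hnear : ∀ s ∈ Icc (0 : ℝ) 1, dist (Complex.exp (f s)) 1 < δ := by
    intro s hs
    have d0 : dist ((z : Cn 2) i) ((γ 0 : Cn 2) i) < δ / 2 := by
      have : dist ((H (z, 0) : Cn 2) i) ((H (γ 0, 0) : Cn 2) i) < δ / 2 := hvu z hzv 0 (by simp)
      rwa [h0, hHγ 0 (by simp)] at this
    have d1 : dist ((H (z, s) : Cn 2) i) ((H (γ 0, s) : Cn 2) i) < δ / 2 := hvu z hzv s hs
    rw [hHγ s hs, hTt s hs, hRt s hs, coe_sflow, coe_sflow, wflow_apply, wflow_apply,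
      dist_eq_norm] at d1
    rw [dist_eq_norm] at d0 ⊢
    set E := Complex.exp (n i * ((T s : ℂ) * Complex.I)) with hE
    have hE1 : ‖E‖ = 1 := by
      rw [hE, show (n i * ((T s : ℂ) * Complex.I) : ℂ) = ((n i * T s : ℝ) : ℂ) * Complex.I by
        push_cast; ring]
      exact Complex.norm_exp_ofReal_mul_I _
    have hF1 : ‖Complex.exp (f s)‖ = 1 := by
      rw [show f s = ((n i * (R s - T s) : ℝ) : ℂ) * Complex.I by
        simp only [hf]; push_cast; ring]
      exact Complex.norm_exp_ofReal_mul_I _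
    have e : Complex.exp (n i * ((R s : ℂ) * Complex.I)) = E * Complex.exp (f s) := by
      rw [hE, hf, ← Complex.exp_add]
      congr 1
      push_cast; ring
    rw [e, mul_assoc, ← mul_sub, norm_mul, hE1, one_mul] at d1
    have e2 : (Complex.exp (f s) - 1) * (γ 0 : Cn 2) i
        = (Complex.exp (f s) * (z : Cn 2) i - (γ 0 : Cn 2) i)
          - Complex.exp (f s) * ((z : Cn 2) i - (γ 0 : Cn 2) i) := by ring
    calc ‖Complex.exp (f s) - 1‖ = ‖(Complex.exp (f s) - 1) * (γ 0 : Cn 2) i‖ := by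
          rw [norm_mul, hx1, mul_one]
      _ ≤ ‖Complex.exp (f s) * (z : Cn 2) i - (γ 0 : Cn 2) i‖
          + ‖Complex.exp (f s) * ((z : Cn 2) i - (γ 0 : Cn 2) i)‖ := by
          rw [e2]; exact norm_sub_le _ _
      _ < δ := by rw [norm_mul, hF1, one_mul]; linarith
  have h2 := eq_log_of_exp_mem_slitPlane (f := f) (by fun_prop) (by simp [hf, hR0, hT0])
    fun s hs => (hlogδ (hnear s hs)).1
  have h3 := (hlogδ (hnear 1 (by simp))).2
  rw [← h2, hf, norm_mul, norm_mul, Complex.norm_I, mul_one, Complex.norm_natCast,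
    Complex.norm_real, Real.norm_eq_abs] at h3
  exact lt_of_mul_lt_mul_left h3 hni.le

theorem isHolonomy_tendsto {X : Type*} [TopologicalSpace X] {leaf : X → Set X} {D : Set X}
    {γ : ℝ → X} {h : X → X} (hγ : γ 1 = γ 0) (hD : γ 0 ∈ D) (hh : IsHolonomy leaf D γ h) :
    Tendsto h (𝓝[D] (γ 0)) (𝓝[D] (γ 0)) := by
  obtain ⟨N, hND, hN, H, hH, hHγ, hH2⟩ := hh
  have hxN : γ 0 ∈ N := mem_of_mem_nhdsWithin hD hN
  refine tendsto_nhdsWithin_iff.mpr ⟨?_, ?_⟩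
  · have h1 : ContinuousOn (fun z => H (z, 1)) N := hH.comp (by fun_prop) fun z hz => ⟨hz, by simp⟩
    have h2 := (h1 _ hxN).tendsto
    rw [hHγ 1 (by simp), hγ] at h2
    refine (h2.mono_left (nhdsWithin_le_of_mem hN)).congr' ?_
    filter_upwards [hN] with z hz
    exact (hH2 z hz).2.1
  · filter_upwards [hN] with z hz
    exact (hH2 z hz).2.2.1

/-- The times of successive returns add up. The tolerance is arbitrary because the induction halves
it. -/
theorem iterate_eq_sflow {D : Set (Sph 2)} {x : Sph 2} {h : Sph 2 → Sph 2} {w : ℝ}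
    (htend : Tendsto h (𝓝[D] x) (𝓝[D] x))
    (hflow : ∀ ε > 0, ∀ᶠ z in 𝓝[D] x, ∃ τ, |τ - w| < ε ∧ h z = sflow n τ z) (j : ℕ) :
    ∀ ε > 0, ∀ᶠ z in 𝓝[D] x, ∃ τ, |τ - j * w| < ε ∧ h^[j] z = sflow n τ z := by
  induction j with
  | zero => exact fun ε hε => Eventually.of_forall fun z => ⟨0, by simpa using hε, by simp⟩
  | succ j ih =>
    intro ε hε
    filter_upwards [htend.eventually (ih (ε / 2) (half_pos hε)), hflow (ε / 2) (half_pos hε)]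
      with z ⟨τ, hτ, hz⟩ ⟨σ, hσ, hz'⟩
    refine ⟨τ + σ, ?_, by rw [Function.iterate_succ_apply, hz, hz', sflow_add]⟩
    have e : τ + σ - ((j + 1 : ℕ) : ℝ) * w = (τ - j * w) + (σ - w) := by push_cast; ring
    rw [e]
    exact (abs_add_le _ _).trans_lt (by linarith)

/-- Near a point, a transversal meets short flow lines only once. -/
theorem HolFoliation.IsTransversal.sflow_eq_self (hn : ∀ i, 0 < n i) {D : Set (Sph 2)} {x : Sph 2}
    (h : IsTransversal (sphereOrbit n) D x) :
    ∃ ε > 0, ∀ᶠ z in 𝓝[D] x, ∀ τ, |τ| < ε → sflow n τ z ∈ D → sflow n τ z = z := by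
  obtain ⟨hx, e, he, hz⟩ := h
  have hxr : x ∈ range e := ⟨(⟨x, hx⟩, 0), (hz ⟨x, hx⟩).1⟩
  have hcont : Continuous fun p : ℝ × Sph 2 => sflow n p.1 p.2 := by fun_prop
  have hev : ∀ᶠ p in 𝓝 (0 : ℝ) ×ˢ 𝓝 x, sflow n p.1 p.2 ∈ range e := by
    rw [← nhds_prod_eq]
    exact hcont.continuousAt.eventually_mem (he.isOpen_range.mem_nhds (by simpa using hxr))
  obtain ⟨P, hP, Q, hQ, hPQ⟩ := eventually_prod_iff.mp hev
  obtain ⟨ε, hε, hPε⟩ := Metric.eventually_nhds_iff.mp hP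
  refine ⟨ε, hε, ?_⟩
  filter_upwards [nhdsWithin_le_nhds hQ, self_mem_nhdsWithin] with z hzQ hzD τ hτ hτD
  have hmem : ∀ t : Ioo (-ε) ε, ∃ p, e p = sflow n t z := fun t =>
    hPQ (hPε (by rw [Real.dist_0_eq_abs, abs_lt]; exact t.2)) hzQ
  choose g hg using hmem
  have hgc : Continuous g := by
    rw [he.isInducing.continuous_iff]
    have : e ∘ g = fun t : Ioo (-ε) ε => sflow n t z := funext hg
    rw [this]
    fun_prop
  -- A leaf may cross the flow box in several lines, so only a local statement is available: near
  -- each time the orbit stays on the line it is on. Connectedness of the time interval then gives a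
  -- single line, which meets `D` once.
  have hloc : IsLocallyConstant fun t => (g t).1 := by
    rw [IsLocallyConstant.iff_eventually_eq]
    intro t
    set d := (g t).1 with hd
    have hline : Continuous fun s : ℝ => e (d, s) := he.continuous.comp (by fun_prop)
    obtain ⟨T, hT, hT0, hTt⟩ := exists_continuous_angle hn hline (hz d).2 (t₀ := 0)
      (by simp [(hz d).1])
    have hinj : Function.Injective T := fun a b hab => by
      have : e (d, a) = e (d, b) := by rw [hTt, hTt, hab]
      simpa using he.injective this
    have hgt : sflow n t z = sflow n (T (g t).2) d := by rw [← hTt, ← hg t]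
    -- The time along a line of the box is continuous and injective, hence strictly monotone, so it
    -- covers an interval around each of its values.
    have hopen : range T ∈ 𝓝 (T (g t).2) := by
      set s := (g t).2
      rcases hT.strictMono_of_inj hinj with hm | hm
      · refine mem_of_superset (Ioo_mem_nhds (hm (sub_one_lt s)) (hm (lt_add_one s))) ?_
        exact (intermediate_value_Ioo (by linarith) hT.continuousOn).trans (image_subset_range _ _)
      · refine mem_of_superset (Ioo_mem_nhds (hm (lt_add_one s)) (hm (sub_one_lt s))) ?_
        exact (intermediate_value_Ioo' (by linarith) hT.continuousOn).trans (image_subset_range _ _)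
    have hshift : Tendsto (fun u : Ioo (-ε) ε => (u : ℝ) - t + T (g t).2) (𝓝 t)
        (𝓝 (T (g t).2)) := by
      have : Continuous fun u : Ioo (-ε) ε => (u : ℝ) - t + T (g t).2 := by fun_prop
      simpa using this.tendsto t
    filter_upwards [hshift.eventually hopen] with u hu
    obtain ⟨s, hs⟩ := hu
    have : e (g u) = e (d, s) := by
      rw [hg u, hTt, hs, sflow_add, ← hgt, ← sflow_add, sub_add_cancel]
    rw [he.injective this]
  have : PreconnectedSpace (Ioo (-ε) ε) := Subtype.preconnectedSpace isPreconnected_Ioo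
  have h1 := hloc.apply_eq_of_preconnectedSpace ⟨τ, abs_lt.mp hτ⟩ ⟨0, by simp [hε]⟩
  have h2 : g ⟨τ, abs_lt.mp hτ⟩ = (⟨_, hτD⟩, 0) := he.injective (by rw [hg, (hz _).1])
  have h3 : g ⟨0, by simp [hε]⟩ = (⟨z, hzD⟩, 0) := he.injective (by rw [hg, (hz _).1]; simp)
  rw [h2, h3] at h1
  exact congrArg Subtype.val h1

/-- A transversal through a point of an exceptional leaf contains generic points close to it. -/
theorem HolFoliation.IsTransversal.frequently_ne_zero {D : Set (Sph 2)} {i : Fin 2} {x : Sph 2}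
    (hxi : x ∈ axisCircle i) (h : IsTransversal (sphereOrbit n) D x) :
    ∃ᶠ z : Sph 2 in 𝓝[D] x, ∀ j, (z : Cn 2) j ≠ 0 := by
  obtain ⟨hx, e, he, hz⟩ := h
  intro hev
  rw [nhdsWithin_eq_map_subtype_coe hx, eventually_map] at hev
  have hex : e (⟨x, hx⟩, 0) = x := (hz ⟨x, hx⟩).1
  -- The flow preserves the vanishing of coordinates. If `D` near `x` met only the axes, so would
  -- the whole flow box near `x`, contradicting the arc built below.
  have hev2 : ∀ᶠ y : Sph 2 in 𝓝 x, ¬ ∀ j, (y : Cn 2) j ≠ 0 := by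
    rw [← hex, ← he.map_nhds_eq, eventually_map]
    filter_upwards [(continuous_fst.tendsto ((⟨x, hx⟩ : D), (0 : ℝ))).eventually hev] with p hp hne
    refine hp fun j hj => ?_
    obtain ⟨t, ht⟩ := (hz p.1).2 p.2
    exact hne j (by rw [← ht]; exact wflow_apply_eq_zero.mpr hj)
  have hx1 := norm_apply_of_mem_axisCircle hxi
  have hpath : Continuous fun t : ℝ => (WithLp.toLp 2 fun j =>
      if j = i then (Real.cos t : ℂ) * (x : Cn 2) i else (Real.sin t : ℂ) : Cn 2) := by
    refine (PiLp.continuous_toLp 2 _).comp (continuous_pi fun j => ?_)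
    split_ifs <;> fun_prop
  have hnorm : ∀ t : ℝ, (WithLp.toLp 2 fun j =>
      if j = i then (Real.cos t : ℂ) * (x : Cn 2) i else (Real.sin t : ℂ) : Cn 2)
        ∈ Metric.sphere (0 : Cn 2) 1 := by
    intro t
    rw [mem_sphere_zero_iff_norm, EuclideanSpace.norm_eq, Real.sqrt_eq_one, Fin.sum_univ_two]
    fin_cases i
    · simp only [Fin.zero_eta, Fin.isValue] at hx1 ⊢
      simp only [if_true, one_ne_zero, if_false, norm_mul, hx1, mul_one, Complex.norm_real,
        Real.norm_eq_abs, sq_abs, Real.cos_sq_add_sin_sq]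
    · simp only [Fin.mk_one, Fin.isValue] at hx1 ⊢
      simp only [if_true, zero_ne_one, if_false, norm_mul, hx1, mul_one, Complex.norm_real,
        Real.norm_eq_abs, sq_abs, Real.sin_sq_add_cos_sq]
  set c : ℝ → Sph 2 := fun t => ⟨_, hnorm t⟩ with hc
  have hcc : Continuous c := hpath.subtype_mk _
  have hc0 : c 0 = x := by
    ext j
    by_cases hj : j = i
    · subst hj; simp [hc]
    · simp [hc, hj, hxi j hj]
  have h1 : ∀ᶠ t in 𝓝[>] (0 : ℝ), ¬ ∀ j, (c t : Cn 2) j ≠ 0 := by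
    refine ((hcc.tendsto 0).mono_left nhdsWithin_le_nhds).eventually
      (p := fun y : Sph 2 => ¬ ∀ j, (y : Cn 2) j ≠ 0) ?_
    rwa [hc0]
  obtain ⟨t, ht, ht0, ht1⟩ :=
    (h1.and (Ioo_mem_nhdsGT (by positivity : (0 : ℝ) < Real.pi / 2))).exists
  refine ht fun j => ?_
  have hcos : Real.cos t ≠ 0 := (Real.cos_pos_of_mem_Ioo ⟨by linarith, ht1⟩).ne'
  have hsin : Real.sin t ≠ 0 := (Real.sin_pos_of_pos_of_lt_pi ht0 (by linarith)).ne'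
  by_cases hj : j = i
  · subst hj
    have hxj : (x : Cn 2) j ≠ 0 := norm_ne_zero_iff.mp (by rw [hx1]; exact one_ne_zero)
    simp only [hc, if_true]
    exact mul_ne_zero (by exact_mod_cast hcos) hxj
  · simp only [hc, hj, if_false]
    exact_mod_cast hsin

/-- The iterates of the holonomy along an exceptional leaf that are trivial. -/
theorem iterate_holonomy_eventuallyEq_iff (hn : ∀ i, 0 < n i) (hc : (n 0).Coprime (n 1))
    {i : Fin 2} {γ : ℝ → Sph 2} (hγ : IsSimpleLoop γ (axisCircle i)) {D : Set (Sph 2)}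
    (hD : IsTransversal (sphereOrbit n) D (γ 0)) {h : Sph 2 → Sph 2}
    (hh : IsHolonomy (sphereOrbit n) D γ h) (j : ℕ) :
    h^[j] =ᶠ[𝓝[D] (γ 0)] id ↔ n i ∣ j := by
  have h0 : γ 0 ∈ axisCircle i := hγ.image_eq ▸ mem_image_of_mem _ (by simp)
  have hni : (0 : ℝ) < n i := by exact_mod_cast hn i
  obtain ⟨T, hT, hT0, hTt, m, hm, hT1⟩ := exists_angle_of_isSimpleLoop hn hγ
  have htend := isHolonomy_tendsto hγ.closed hD.1 hh
  have hiter := iterate_eq_sflow htend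
    (fun ε hε => holonomy_eq_sflow hn h0 hT hT0 hTt hD.1 hh hε) j
  constructor
  -- A fixed generic point has flow time `2πk`, which is also closer than `2π / n i` to `j * T 1 = j
  -- * m * (2π / n i)`; so the two agree and `n i` divides `j * m`, where `m = ±1`.
  · intro hid
    have hε : 0 < 2 * Real.pi / n i := div_pos Real.two_pi_pos hni
    obtain ⟨z, hz, ⟨τ, hτ, hzτ⟩, hzid⟩ :=
      ((hD.frequently_ne_zero h0).and_eventually ((hiter _ hε).and hid)).exists
    obtain ⟨k, hk⟩ := exists_int_of_sflow_eq_self hc (hzτ.symm.trans hzid) hz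
    have e : τ - j * T 1 = ((n i * k - j * m : ℤ) : ℝ) * (2 * Real.pi / n i) := by
      rw [hk, hT1]; push_cast; field_simp
    rw [e, abs_mul, abs_of_pos hε] at hτ
    have h1 : |((n i * k - j * m : ℤ) : ℝ)| < 1 := by
      by_contra hcon
      exact absurd hτ (not_lt.mpr (le_mul_of_one_le_left hε.le (not_lt.mp hcon)))
    have h2 : (n i * k - j * m : ℤ) = 0 := by
      rw [← Int.abs_lt_one_iff]; exact_mod_cast h1
    have hm1 : m.natAbs = 1 := by
      rw [Int.abs_eq_natAbs] at hm; exact_mod_cast hm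
    have h3 : (n i : ℤ) ∣ j * m := ⟨k, by linarith⟩
    rwa [← Int.natAbs_dvd_natAbs, Int.natAbs_mul, hm1, mul_one] at h3
  -- Now `j * T 1` is a multiple of the common period `2π`. The iterate is therefore a short flow
  -- that returns to `D`, hence the identity.
  · rintro ⟨a, ha⟩
    obtain ⟨ε, hε, hself⟩ := IsTransversal.sflow_eq_self hn hD
    have hDj : ∀ᶠ z in 𝓝[D] (γ 0), h^[j] z ∈ D :=
      (htend.iterate j).eventually self_mem_nhdsWithin
    filter_upwards [hself, hDj, hiter ε hε] with z hz hzD ⟨τ, hτ, hzτ⟩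
    have e : τ = (τ - j * T 1) + ((a * m : ℤ) : ℝ) * (2 * Real.pi) := by
      rw [hT1, ha]; push_cast; field_simp; ring
    have h1 : h^[j] z = sflow n (τ - j * T 1) z := by
      rw [hzτ]
      conv_lhs => rw [e]
      rw [sflow_add, sflow_int_period]
    rw [h1] at hzD ⊢
    exact hz _ hτ hzD

end SphereHolonomy

/-! ### Explicit transversals and the orders of the exceptional leaves -/

section SphereHolonomyOrder

variable {n : Fin 2 → ℕ}

/-- The points of the sphere whose `i`-th coordinate is a positive real number. -/
def positiveSection (i : Fin 2) : Set (Sph 2) :=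
  {z | (z : Cn 2) i ≠ 0 ∧ Complex.arg ((z : Cn 2) i) = 0}

theorem sflow_apply_eq (hn : ∀ i, 0 < n i) (θ : ℝ) (z : Sph 2) (i : Fin 2) :
    (sflow n (θ / n i) z : Cn 2) i = Complex.exp (θ * Complex.I) * (z : Cn 2) i := by
  have hni : ((n i : ℕ) : ℂ) ≠ 0 := by exact_mod_cast (hn i).ne'
  rw [coe_sflow, wflow_apply]
  congr 2
  push_cast
  field_simp

theorem isTransversal_positiveSection (hn : ∀ i, 0 < n i) {i : Fin 2} {x : Sph 2}
    (hx : x ∈ positiveSection i) :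
    IsTransversal (sphereOrbit n) (positiveSection i) x := by
  set Y : Set (Sph 2) := {w | (w : Cn 2) i ∈ Complex.slitPlane} with hY
  have hYopen : IsOpen Y := Complex.isOpen_slitPlane.preimage (by fun_prop)
  -- `2 * arctan` maps `ℝ` onto `(-π, π)`, so turning the `i`-th coordinate by this angle sweeps out
  -- exactly the slit-plane region `Y`; `g` reads off section point and parameter.
  set e : positiveSection i × ℝ → Sph 2 := fun p => sflow n (2 * Real.arctan p.2 / n i) p.1 with he
  have hec : Continuous e := by fun_prop
  have hcoord : ∀ p, (e p : Cn 2) i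
      = (‖(p.1 : Cn 2) i‖ : ℝ) * Complex.exp ((2 * Real.arctan p.2 : ℝ) * Complex.I) := by
    intro p
    have h1 := Complex.norm_mul_exp_arg_mul_I ((p.1 : Cn 2) i)
    rw [p.1.2.2, Complex.ofReal_zero, zero_mul, Complex.exp_zero, mul_one] at h1
    rw [he, sflow_apply_eq hn, h1, mul_comm]
  have harg : ∀ p, Complex.arg ((e p : Cn 2) i) = 2 * Real.arctan p.2 := by
    intro p
    rw [hcoord, Complex.arg_real_mul _ (norm_pos_iff.mpr p.1.2.1), Complex.arg_exp_mul_I,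
      toIocMod_eq_self]
    exact ⟨by linarith [Real.neg_pi_div_two_lt_arctan p.2],
      by linarith [Real.arctan_lt_pi_div_two p.2]⟩
  have heY : ∀ p, e p ∈ Y := by
    intro p
    rw [hY, mem_ofPred_eq, Complex.mem_slitPlane_iff_arg, harg]
    refine ⟨by linarith [Real.arctan_lt_pi_div_two p.2], ?_⟩
    exact fun h => p.1.2.1 (wflow_apply_eq_zero.mp h)
  set g : Y → Sph 2 × ℝ := fun w => (sflow n (-Complex.arg ((w : Cn 2) i) / n i) w,
    Real.tan (Complex.arg ((w : Cn 2) i) / 2)) with hg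
  have hargc : Continuous fun w : Y => Complex.arg ((w : Cn 2) i) :=
    continuous_iff_continuousAt.mpr fun w =>
      (Complex.continuousAt_arg w.2).comp (f := fun w : Y => (w : Cn 2) i) (by fun_prop)
  have hgc : Continuous g := by
    refine Continuous.prodMk (by fun_prop) (continuous_iff_continuousAt.mpr fun w => ?_)
    refine (Real.continuousAt_tan.mpr ?_).comp (f := fun w : Y => Complex.arg ((w : Cn 2) i) / 2)
      (hargc.div_const 2).continuousAt
    have h1 := Complex.mem_slitPlane_iff_arg.mp w.2
    exact (Real.cos_pos_of_mem_Ioo ⟨by linarith [Complex.neg_pi_lt_arg ((w : Cn 2) i)],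
      by linarith [lt_of_le_of_ne (Complex.arg_le_pi ((w : Cn 2) i)) h1.1]⟩).ne'
  have hge : ∀ p, g ⟨e p, heY p⟩ = (p.1.1, p.2) := by
    intro p
    simp only [hg, harg]
    rw [mul_div_cancel_left₀ _ two_ne_zero, Real.tan_arctan, he]
    simp only
    rw [← sflow_add, neg_div, neg_add_cancel, sflow_zero_time]
  have hemb : IsEmbedding e := by
    have h1 : IsEmbedding (g ∘ fun p => (⟨e p, heY p⟩ : Y)) := by
      have : (g ∘ fun p => (⟨e p, heY p⟩ : Y)) = Prod.map Subtype.val id := funext hge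
      rw [this]
      exact IsEmbedding.subtypeVal.prodMap .id
    exact IsEmbedding.subtypeVal.comp (IsEmbedding.of_comp (hec.subtype_mk _) hgc h1)
  have hrange : range e = Y := by
    refine Subset.antisymm (range_subset_iff.mpr heY) fun w hw => ?_
    have h1 := Complex.mem_slitPlane_iff_arg.mp hw
    have hw' : (sflow n (-Complex.arg ((w : Cn 2) i) / n i) w : Cn 2) i
        = (‖(w : Cn 2) i‖ : ℝ) := by
      rw [sflow_apply_eq hn]
      conv_lhs => rw [← Complex.norm_mul_exp_arg_mul_I ((w : Cn 2) i)]
      rw [mul_left_comm, Complex.norm_mul_exp_arg_mul_I, ← Complex.exp_add]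
      simp
    have hmem : sflow n (-Complex.arg ((w : Cn 2) i) / n i) w ∈ positiveSection i := by
      refine ⟨?_, ?_⟩
      · rw [hw', Complex.ofReal_ne_zero, norm_ne_zero_iff]; exact h1.2
      · rw [hw', Complex.arg_ofReal_of_nonneg (norm_nonneg _)]
    refine ⟨(⟨_, hmem⟩, Real.tan (Complex.arg ((w : Cn 2) i) / 2)), ?_⟩
    simp only [he]
    rw [Real.arctan_tan (by linarith [Complex.neg_pi_lt_arg ((w : Cn 2) i)])
      (by linarith [lt_of_le_of_ne (Complex.arg_le_pi ((w : Cn 2) i)) h1.1]),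
      mul_div_cancel₀ _ two_ne_zero, ← sflow_add, neg_div, add_neg_cancel, sflow_zero_time]
  exact ⟨hx, e, ⟨hemb, hrange ▸ hYopen⟩, fun z => ⟨by simp [he], fun s => ⟨_, rfl⟩⟩⟩

/-- The holonomy order of an exceptional leaf is the weight of its axis. -/
theorem hasHolonomyOrder_axisCircle_iff (hn : ∀ i, 0 < n i) (hc : (n 0).Coprime (n 1))
    (i : Fin 2) (k : ℕ) : HasHolonomyOrder (sphereOrbit n) (axisCircle i) k ↔ k = n i := by
  -- The order is `n i` for every choice of loop, transversal and holonomy map. One explicit choice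
  -- then suffices for existence.
  have horder : ∀ {γ : ℝ → Sph 2} {D : Set (Sph 2)} {h : Sph 2 → Sph 2},
      IsSimpleLoop γ (axisCircle i) → IsTransversal (sphereOrbit n) D (γ 0) →
      IsHolonomy (sphereOrbit n) D γ h → HasGermOrder D (γ 0) h (n i) := by
    intro γ D h hγ hD hh
    refine ⟨⟨hn i, (iterate_holonomy_eventuallyEq_iff hn hc hγ hD hh _).mpr dvd_rfl⟩, ?_⟩
    rintro j ⟨hj, hj'⟩
    exact Nat.le_of_dvd hj ((iterate_holonomy_eventuallyEq_iff hn hc hγ hD hh _).mp hj')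
  constructor
  · rintro ⟨γ, D, h, hγ, -, hD, hh, hk⟩
    exact hk.unique (horder hγ hD hh)
  · rintro rfl
    set x : Sph 2 := ⟨EuclideanSpace.single i 1, by simp⟩ with hx
    have hxa : x ∈ axisCircle i := fun j hj => by simp [hx, hj]
    have hxp : x ∈ positiveSection i := by simp [positiveSection, hx]
    have hγ := isSimpleLoop_axisCircle hn hxa
    have hγ0 : sflow n (2 * Real.pi / n i * 0) x = x := by simp
    have hD : IsTransversal (sphereOrbit n) (positiveSection i)
        (sflow n (2 * Real.pi / n i * 0) x) := by
      rw [hγ0]; exact isTransversal_positiveSection hn hxp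
    have hh : IsHolonomy (sphereOrbit n) (positiveSection i)
        (fun t => sflow n (2 * Real.pi / n i * t) x) (sflow n (2 * Real.pi / n i)) := by
      refine ⟨positiveSection i, Subset.rfl, self_mem_nhdsWithin,
        fun p => sflow n (2 * Real.pi / n i * p.2) p.1, Continuous.continuousOn (by fun_prop),
        fun s _ => by simp only [hγ0], fun z hz => ⟨by simp, by simp, ?_, fun s _ => ⟨_, rfl⟩⟩⟩
      have : (sflow n (2 * Real.pi / n i) z : Cn 2) i = (z : Cn 2) i := by
        rw [sflow_apply_eq hn, Complex.ofReal_mul, Complex.ofReal_ofNat, Complex.exp_two_pi_mul_I,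
          one_mul]
      unfold positiveSection at hz ⊢
      rwa [mem_ofPred_eq, this]
    exact ⟨_, _, _, hγ, fun z hz => sphereOrbit_axisCircle hn hz, hD, hh, horder hγ hD hh⟩

end SphereHolonomyOrder

/-! ### Assembly of the main theorem -/

theorem traceLeaf_linFoliation {l : ℚ} (hl : 0 < l) :
    (linFoliation l (Rat.cast_pos.mpr hl)).traceLeaf = sphereOrbit (ratWeights l) :=
  funext fun z => traceLeaf_eq (ratWeights_pos hl) _ (coe_eq_ratWeights_div hl) z

theorem ratWeights_eq {l : ℚ} (hl : 0 < l) {p q : ℕ} (hpq : p.Coprime q) (h : l = (p : ℚ) / q) :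
    ratWeights l 0 = p ∧ ratWeights l 1 = q := by
  have hq : q ≠ 0 := by
    rintro rfl
    simp only [Nat.cast_zero, div_zero] at h
    exact hl.ne' h
  have h1 : l = ((p : ℤ) : ℚ) / ((q : ℤ) : ℚ) := by rw [h]; push_cast; rfl
  have hq' : (0 : ℤ) < q := by exact_mod_cast Nat.pos_of_ne_zero hq
  constructor
  · have := Rat.num_div_eq_of_coprime hq' (a := p) (by simpa using hpq)
    rw [← h1] at this
    simp [ratWeights, this]
  · have := Rat.den_div_eq_of_coprime hq' (a := p) (by simpa using hpq)
    rw [← h1] at this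
    simp only [ratWeights, Matrix.cons_val_one]
    exact_mod_cast this

theorem mainTheorem4 (l m : ℚ) (hl : 0 < l) (hm : 0 < m) :
    -- Write `F` and `G` for the germs of `l` and `m`.
    ∀ F G : Foliation 2, F = linFoliation l (Rat.cast_pos.mpr hl) →
      G = linFoliation m (Rat.cast_pos.mpr hm) →
    -- Classification.
    (F.TopEquiv G ↔ l = m ∨ l = 1 / m) ∧
    -- Leaves of the trace foliation and orders of their holonomies, for `l = p / q` in lowest terms.
    (∀ p q : ℕ, p.Coprime q → l = (p : ℚ) / q →
      (∀ z : Sph 2, IsClosed (F.traceLeaf z)) ∧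
      (∀ z ∈ circleX, F.traceLeaf z = circleX) ∧
      (∀ z ∈ circleY, F.traceLeaf z = circleY) ∧
      (∀ z : Sph 2, z ∉ circleX → z ∉ circleY →
        IsTorusKnot ‖(z : Cn 2) 0‖ p q (F.traceLeaf z)) ∧
      (∀ k : ℕ, HasHolonomyOrder F.traceLeaf circleX k ↔ k = q) ∧
      (∀ k : ℕ, HasHolonomyOrder F.traceLeaf circleY k ↔ k = p)) ∧
    -- Homeomorphisms that map trace leaves onto trace leaves preserve the orders of the holonomies.
    (∀ φ : Sph 2 ≃ₜ Sph 2, (∀ z, φ '' F.traceLeaf z = G.traceLeaf (φ z)) →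
      ∀ (z : Sph 2) (k : ℕ), HasHolonomyOrder F.traceLeaf (F.traceLeaf z) k ↔
        HasHolonomyOrder G.traceLeaf (φ '' F.traceLeaf z) k) ∧
    -- The unordered pair of the orders at the two exceptional leaves is an invariant of the germ.
    (F.TopEquiv G → ∀ a b c d : ℕ,
      HasHolonomyOrder F.traceLeaf circleX a → HasHolonomyOrder F.traceLeaf circleY b →
      HasHolonomyOrder G.traceLeaf circleX c → HasHolonomyOrder G.traceLeaf circleY d →
      s(a, b) = s(c, d)) := by
  rintro F G rfl rfl
  have hn := ratWeights_pos hl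
  have hc := ratWeights_coprime hl
  refine ⟨linFoliation_topEquiv_iff hl hm, ?_, fun φ hφ z k => hasHolonomyOrder_image_iff φ hφ, ?_⟩
  · intro p q hpq h
    obtain ⟨hp, hq⟩ := ratWeights_eq hl hpq h
    rw [traceLeaf_linFoliation hl, circleX_eq, circleY_eq]
    refine ⟨isClosed_sphereOrbit, fun z hz => sphereOrbit_axisCircle hn hz,
      fun z hz => sphereOrbit_axisCircle hn hz, fun z h1 h0 => ?_, fun k => ?_, fun k => ?_⟩
    · rw [← circleX_eq] at h1
      rw [← circleY_eq] at h0
      rw [← hp, ← hq]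
      exact isTorusKnot_sphereOrbit hc (Fin.forall_fin_two.mpr ⟨h1, h0⟩)
    · rw [hasHolonomyOrder_axisCircle_iff hn hc, hq]
    · rw [hasHolonomyOrder_axisCircle_iff hn hc, hp]
  · rintro ⟨φ, -, -, h0, hφ0, hφ⟩ a b c d
    have hn' := ratWeights_pos hm
    have hc' := ratWeights_coprime hm
    rw [traceLeaf_linFoliation hl, traceLeaf_linFoliation hm, circleX_eq, circleY_eq]
    simp only [hasHolonomyOrder_axisCircle_iff hn hc, hasHolonomyOrder_axisCircle_iff hn' hc']
    rintro rfl rfl rfl rfl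
    rcases LeafEquiv.weights_eq hn hc _ (coe_eq_ratWeights_div hl) hn' hc' _
      (coe_eq_ratWeights_div hm) ⟨h0, hφ0, hφ⟩ with ⟨e0, e1⟩ | ⟨e0, e1⟩
    · rw [e0, e1]
    · rw [e0, e1, Sym2.eq_swap]
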